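/- Let $\Pi$ be an arbitrary finite projective plane of order $p^2$, where $p\ge 7$ is prime. Let $\mathrm{C}(\Pi)$ be the $p$-ary code of $\Pi$, i.e. the $\mathbb{F}_p$-span, inside the space of $\mathbb{F}_p$-valued functions on the points of $\Pi$, of the incidence vectors of the lines; let $\mathrm{C}(\Pi)^\perp$ be its dual code with respect to the standard dot product, and let $d^\perp$ be the minimum weight of $\mathrm{C}(\Pi)^\perp$, i.e. the least number of nonzero entries of a nonzero code word. An incidence structure $(\mathcal P,\mathcal L)$ is embedded in $\Pi$ if there are given injective maps from $\mathcal P$ to the points of $\Pi$ and from $\mathcal L$ to the lines of $\Pi$ that preserve both incidence and non-incidence; its incidence vector is the $0/1$-vector of the image of $\mathcal P$, and two embedded structures are disjoint if the images of their point sets are disjoint. An antipodal plane of order $s\ge 2$ is an incidence structure $(\mathcal P,\mathcal L)$ whose lines are subsets of $\mathcal P$ of size at least two, in which two distinct points lie on at most one common line, $|\mathcal P|=|\mathcal L|=s^2+s+2$, every line contains exactly $s+1$ points, and every point lies on exactly $s+1$ lines. A Baer subplane of $\Pi$ is an embedded projective plane of order $p$. Then $d^\perp=2p^2-2p+2$,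 or $d^\perp=2p^2-2p+4$, or $d^\perp\ge 2p^2-2p+5$. Furthermore: - if $d^\perp=2p^2-2p+2$, then every code word of $\mathrm{C}(\Pi)^\perp$ of weight $d^\perp$ is of the form $\lambda(v_1-v_2)$ with $\lambda\in\mathbb{F}_p\setminus\{0\}$ and $v_1,v_2$ the incidence vectors of two disjoint projective planes of order $p-1$ embedded in $\Pi$; - if $d^\perp=2p^2-2p+4$, then every code word of $\mathrm{C}(\Pi)^\perp$ of weight $d^\perp$ is of the form $\lambda(v_1-v_2)$ with $\lambda\in\mathbb{F}_p\setminus\{0\}$ and $v_1,v_2$ the incidence vectors of two disjoint antipodal planes of order $p-1$ embedded in $\Pi$. Finally, $d^\perp\le 2p^2-p$ if $\Pi$ contains a Baer subplane. -/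

import Mathlib

universe u v u' v'

namespace PlaneCode

open Configuration

/-- The incidence vector, with entries in `F`, of a set `S` of points. -/
noncomputable def incidenceVector {P : Type u} (F : Type v) [Zero F] [One F] (S : Set P) : P → F :=
  S.indicator 1

/-- The code of the incidence structure `(P, L)` over `F`: the `F`-span of the incidence vectors
of the lines, that is, of the rows of the line-by-point incidence matrix. -/
noncomputable def code (P : Type u) (L : Type v) [Membership P L] (F : Type u') [CommRing F] :
    Submodule F (P → F) :=
  Submodule.span F (Set.range fun l : L => incidenceVector F {x : P | x ∈ l})

/-- The dual of a linear code with respect to the standard dot product. -/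
def dualCode {ι : Type u} [Fintype ι] {F : Type v} [CommRing F] (C : Submodule F (ι → F)) :
    Submodule F (ι → F) where
  carrier := {w | ∀ c ∈ C, w ⬝ᵥ c = 0}
  zero_mem' := fun c _ => zero_dotProduct c
  add_mem' := fun {a b} ha hb c hc => by rw [add_dotProduct, ha c hc, hb c hc, add_zero]
  smul_mem' := fun r a ha c hc => by rw [smul_dotProduct, ha c hc, smul_zero]

/-- The minimum weight of a linear code: the least Hamming weight of a nonzero code word. -/
noncomputable def minWeight {ι : Type u} [Fintype ι] {F : Type v} [CommRing F] [DecidableEq F]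
    (C : Submodule F (ι → F)) : ℕ :=
  sInf {w | ∃ c ∈ C, c ≠ 0 ∧ hammingNorm c = w}

/-- An embedding of the incidence structure `(Q, M)` in `(P, L)`: injective maps on points and on
lines that preserve incidence and non-incidence. -/
structure IncidenceEmbedding (Q : Type u') (M : Type v') (P : Type u) (L : Type v)
    [Membership Q M] [Membership P L] where
  onPoints : Q → P
  onLines : M → L
  onPoints_injective : Function.Injective onPoints
  onLines_injective : Function.Injective onLines
  mem_iff : ∀ (x : Q) (l : M), onPoints x ∈ onLines l ↔ x ∈ l

/-- A partial linear space: every line has at least two points, and two distinct points are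
on at most one common line. (Hence a line is determined by its set of points.) -/
structure IsPartialLinearSpace (Q : Type u) (M : Type v) [Membership Q M] : Prop where
  nontrivial : ∀ l : M, {x : Q | x ∈ l}.Nontrivial
  line_unique : ∀ (x y : Q) (l m : M), x ≠ y → x ∈ l → y ∈ l → x ∈ m → y ∈ m → l = m

/-- An antipodal plane of order `s ≥ 2`. -/
structure IsAntipodalPlane (Q : Type u) (M : Type v) [Membership Q M] (s : ℕ) : Prop
    extends IsPartialLinearSpace Q M where
  two_le : 2 ≤ s
  card_points : Nat.card Q = s ^ 2 + s + 2
  card_lines : Nat.card M = s ^ 2 + s + 2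
  pointCount_eq : ∀ l : M, pointCount Q l = s + 1
  lineCount_eq : ∀ x : Q, lineCount M x = s + 1

/-- `S` is the point set of a projective plane of order `s` embedded in `(P, L)`. -/
def IsEmbeddedProjectivePlane {P : Type u} (L : Type v) [Membership P L] (S : Set P) (s : ℕ) :
    Prop :=
  ∃ (Q : Type u) (M : Type v) (_ : Membership Q M) (_ : ProjectivePlane Q M)
    (e : IncidenceEmbedding Q M P L),
    ProjectivePlane.order Q M = s ∧ Set.range e.onPoints = S

/-- `S` is the point set of an antipodal plane of order `s` embedded in `(P, L)`. -/
def IsEmbeddedAntipodalPlane {P : Type u} (L : Type v) [Membership P L] (S : Set P) (s : ℕ) :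
    Prop :=
  ∃ (Q : Type u) (M : Type v) (_ : Membership Q M) (e : IncidenceEmbedding Q M P L),
    IsAntipodalPlane Q M s ∧ Set.range e.onPoints = S

/-- `S` is the point set of a Baer subplane of the projective plane `(P, L)`: an embedded
projective plane whose order is the square root of the order of `(P, L)`. -/
def IsBaerSubplane {P : Type u} (L : Type v) [Membership P L] [ProjectivePlane P L]
    (S : Set P) : Prop :=
  ∃ n : ℕ, n ^ 2 = ProjectivePlane.order P L ∧ IsEmbeddedProjectivePlane L S n

end PlaneCode

/-! Scale a dual word `c` so that some entry is 1, and lift its entries to 0, …, p-1. On a line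
through a point of value 1 the lifted sum is a positive multiple p(e+1) of p; call e the excess. Let
κ be the total excess over the pencil of that point, and κ' its analogue for `-c`. The lifts of a
and -a add up to p for a ≠ 0, so words of weight at most 2p²+2 have weight exactly 2p²-2p+2+κ+κ'
(`exists_antipodal_bounds`). This gives the lower bound. It remains to understand k = κ+κ' ≤ 2.

Local inequalities on each line, summed over a pencil, restrict the values that occur. Measured in
multiples of a value u whose pair {u, -u} is almost the rarest, the values form a symmetric interval
(`valueCount_pred_pos`). The largest multiple is itself such a value, and the two interval
structures are compatible only if the nonzero values are a single pair {u, -u} or all of them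
(`two_values_or_all_values`).

A second-moment count excludes the latter. If all values occur, each occurs at least 2p+1-k times,
which leaves almost no slack in the weight. Comparing, on every line, pairs of points of ratio -2
with pairs of ratio 1 and -1 then gives a contradiction (`not_all_values`); p = 7 needs a sharper
line inequality.

For values ±1, subtracting the two lifted sums gives κ = κ', so k = 1 is impossible. A line through
a point of value 1 carries p, 1 or 2 points of that value (`exists_line_excess_of_two_values`), and
exactly p lines of the first kind pass through each such point. These lines form a projective plane
if κ = 0 and an antipodal plane if κ = 1. The Baer bound comes from the difference between a Baer
subplane and one of its lines. -/

namespace PlaneCode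

open Configuration Finset

/-! ### Residues summing to -1: the other points of a line through a point of value 1. -/

section ZeroSum

variable {p : ℕ} {ι : Type*}

lemma sum_val_le_mul_card (A : Finset ι) (z : ι → ZMod p) (b : ℕ)
    (h : ∀ y ∈ A, z y ≠ 0 → (z y).val ≤ b) :
    ∑ y ∈ A, (z y).val ≤ #{y ∈ A | z y ≠ 0} * b := by
  classical
  rw [← sum_filter_add_sum_filter_not A (fun y => z y ≠ 0)]
  have h0 : ∑ y ∈ A with ¬ z y ≠ 0, (z y).val = 0 := by
    refine sum_eq_zero fun y hy => ?_
    simp only [mem_filter, not_not] at hy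
    simp [hy.2]
  rw [h0, add_zero, ← smul_eq_mul]
  exact sum_le_card_nsmul _ _ _ fun y hy => h y (mem_filter.1 hy).1 (mem_filter.1 hy).2

lemma exists_sum_val_add_one_eq [Fact p.Prime] (A : Finset ι) (z : ι → ZMod p)
    (hz : ∑ y ∈ A, z y = -1) : ∃ e, ∑ y ∈ A, (z y).val + 1 = p * (e + 1) := by
  have hd : p ∣ ∑ y ∈ A, (z y).val + 1 := by
    rw [← CharP.cast_eq_zero_iff (ZMod p) p]
    push_cast
    simp [hz]
  obtain ⟨q, hq⟩ := hd
  rcases q with _ | e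
  · simp at hq
  · exact ⟨e, hq⟩

lemma card_mul_le_two_mul_sum_val (A : Finset ι) (z : ι → ZMod p) :
    #{y ∈ A | p < 2 * (z y).val} * (p + 1) ≤ 2 * ∑ y ∈ A, (z y).val := by
  rw [← smul_eq_mul, mul_sum]
  calc _ ≤ ∑ y ∈ A with p < 2 * (z y).val, 2 * (z y).val :=
        card_nsmul_le_sum _ _ _ fun y hy => (mem_filter.1 hy).2
    _ ≤ _ := sum_le_sum_of_subset (filter_subset _ _)

/-- A large lift is at least (p+1)/2, so 2e+2 of them would sum to at least (e+1)(p+1), more than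
p(e+1)-1. -/
lemma card_large_le [Fact p.Prime] (A : Finset ι) (z : ι → ZMod p) {e : ℕ}
    (he : ∑ y ∈ A, (z y).val + 1 = p * (e + 1)) :
    #{y ∈ A | p < 2 * (z y).val} ≤ 2 * e + 1 := by
  have h1 := card_mul_le_two_mul_sum_val A z
  by_contra! h
  have : (2 * e + 2) * (p + 1) ≤ #{y ∈ A | p < 2 * (z y).val} * (p + 1) :=
    Nat.mul_le_mul_right _ h
  nlinarith

/-- Lifts are at most p-1, while the required sum is (e+1)(p-1)+e; for e ≥ 1 this needs more than
e+1 terms. -/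
lemma excess_le [Fact p.Prime] (A : Finset ι) (z : ι → ZMod p) {e : ℕ} (he0 : 1 ≤ e)
    (he : ∑ y ∈ A, (z y).val + 1 = p * (e + 1)) : e + 2 ≤ #{y ∈ A | z y ≠ 0} := by
  have hp := (Fact.out : p.Prime).two_le
  have h1 := sum_val_le_mul_card A z (p - 1) fun y _ _ => Nat.le_sub_one_of_lt (ZMod.val_lt _)
  by_contra! h
  have h2 : #{y ∈ A | z y ≠ 0} * (p - 1) ≤ (e + 1) * (p - 1) :=
    Nat.mul_le_mul_right _ (by omega)
  obtain ⟨q, rfl⟩ : ∃ q, p = q + 1 := ⟨p - 1, by omega⟩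
  simp only [Nat.add_sub_cancel] at h1 h2
  nlinarith

/-- With excess 0, a lone nonzero entry must be -1 and is counted twice; positive excess is covered
by `excess_le`. -/
lemma two_le_card_add [Fact p.Prime] (A : Finset ι) (z : ι → ZMod p) {e : ℕ}
    (hz : ∑ y ∈ A, z y = -1) (he : ∑ y ∈ A, (z y).val + 1 = p * (e + 1)) :
    2 + e ≤ #{y ∈ A | z y ≠ 0} + #{y ∈ A | z y = -1} := by
  classical
  rcases Nat.eq_zero_or_pos e with rfl | he0
  · rw [← sum_filter_ne_zero] at hz
    by_contra! h
    have hs : #{y ∈ A | z y ≠ 0} ≠ 0 := by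
      intro h0
      rw [card_eq_zero] at h0
      rw [h0] at hz
      simp at hz
    obtain ⟨y, hy⟩ := card_eq_one.1 (show #{y ∈ A | z y ≠ 0} = 1 by omega)
    rw [hy, sum_singleton] at hz
    have hyA : y ∈ A := by
      have : y ∈ ({y ∈ A | z y ≠ 0} : Finset ι) := by rw [hy]; simp
      exact (mem_filter.1 this).1
    have : 0 < #{y ∈ A | z y = -1} := card_pos.2 ⟨y, by simp [hyA, hz]⟩
    omega
  · have := excess_le A z he0 he
    omega

lemma val_neg_natCast [Fact p.Prime] {i : ℕ} (hi : 0 < i) (hip : i < p) :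
    (-(i : ZMod p)).val = p - i := by
  have h : ((i : ℕ) : ZMod p) ≠ 0 := by
    rw [Ne, CharP.cast_eq_zero_iff (ZMod p) p]
    exact fun h => absurd (Nat.le_of_dvd hi h) (by omega)
  have : NeZero (i : ZMod p) := ⟨h⟩
  rw [ZMod.val_neg_of_ne_zero, ZMod.val_cast_of_lt hip]

/-- If -i is present, the remaining entries sum to i-1, which no single entry supplies. Hence at
excess 0 there are at least three nonzero entries, and at most one equals -i because -i has a large
lift. -/
lemma card_neg_add_two_le [Fact p.Prime] (A : Finset ι) (z : ι → ZMod p) {e : ℕ}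
    (hz : ∑ y ∈ A, z y = -1) (he : ∑ y ∈ A, (z y).val + 1 = p * (e + 1))
    {i : ℕ} (hi : 2 ≤ i) (hip : 2 * i < p) (hA : ∀ y ∈ A, z y ≠ (i - 1 : ℕ)) :
    #{y ∈ A | z y = -(i : ZMod p)} + 2 ≤ #{y ∈ A | z y ≠ 0} + #{y ∈ A | z y = -1} + 2 * e := by
  classical
  have h1 := two_le_card_add A z hz he
  rcases Nat.eq_zero_or_pos #{y ∈ A | z y = -(i : ZMod p)} with h0 | h0
  · omega
  have hv := val_neg_natCast (p := p) (i := i) (by omega) (by omega)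
  have hab : #{y ∈ A | z y = -(i : ZMod p)} ≤ #{y ∈ A | p < 2 * (z y).val} := by
    refine card_le_card fun y hy => ?_
    rw [mem_filter] at hy ⊢
    rw [hy.2, hv]
    exact ⟨hy.1, by omega⟩
  have hb := card_large_le A z he
  rcases Nat.eq_zero_or_pos e with rfl | he0
  · obtain ⟨y, hy⟩ := card_pos.1 h0
    rw [mem_filter] at hy
    suffices 3 ≤ #{y ∈ A | z y ≠ 0} by omega
    have hi0 : (-(i : ZMod p)) ≠ 0 := by
      intro h
      rw [h, ZMod.val_zero] at hv
      omega
    have hyS : y ∈ ({y ∈ A | z y ≠ 0} : Finset ι) := by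
      rw [mem_filter, hy.2]
      exact ⟨hy.1, hi0⟩
    rw [← sum_filter_ne_zero, ← add_sum_erase _ _ hyS, hy.2] at hz
    have hE : ∑ x ∈ ({y ∈ A | z y ≠ 0} : Finset ι).erase y, z x = ((i - 1 : ℕ) : ZMod p) := by
      rw [Nat.cast_sub (by omega)]
      push_cast
      linear_combination hz
    by_contra! hlt
    have hc := card_erase_of_mem hyS
    have : #((({y ∈ A | z y ≠ 0} : Finset ι)).erase y) = 0 ∨
      #((({y ∈ A | z y ≠ 0} : Finset ι)).erase y) = 1 := by omega
    rcases this with h | h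
    · rw [card_eq_zero] at h
      rw [h, sum_empty] at hE
      have := congrArg ZMod.val hE
      rw [ZMod.val_zero, ZMod.val_cast_of_lt (by omega)] at this
      omega
    · obtain ⟨x, hx⟩ := card_eq_one.1 h
      have hxA : x ∈ ({y ∈ A | z y ≠ 0} : Finset ι).erase y := by rw [hx]; simp
      rw [hx, sum_singleton] at hE
      exact hA x (mem_filter.1 (mem_erase.1 hxA).2).1 hE
  · have := excess_le A z he0 he
    omega

/-- At excess 0 the lifts sum to p-1, so j cannot coexist with a large lift, which is at least p-j.
This incompatibility will make the extreme pair {j, -j} almost as rare as {1, -1}. -/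
lemma card_max_add_two_mul_card_large_le [Fact p.Prime] (A : Finset ι) (z : ι → ZMod p) {e : ℕ}
    (hz : ∑ y ∈ A, z y = -1) (he : ∑ y ∈ A, (z y).val + 1 = p * (e + 1))
    {j : ℕ} (hj : 0 < j) (hjp : 2 * j < p)
    (hA : ∀ y ∈ A, z y ≠ 0 → (z y).val ≤ j ∨ p ≤ (z y).val + j) :
    #{y ∈ A | z y = (j : ZMod p)} + 2 * #{y ∈ A | p < 2 * (z y).val} ≤
      #{y ∈ A | z y ≠ 0} + #{y ∈ A | z y = -1} + 3 * e := by
  classical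
  have h1 := two_le_card_add A z hz he
  have hb := card_large_le A z he
  have hv : ((j : ZMod p)).val = j := ZMod.val_cast_of_lt (by omega)
  have hj0 : (j : ZMod p) ≠ 0 := by
    intro h
    rw [h, ZMod.val_zero] at hv
    omega
  have hab : #{y ∈ A | z y = (j : ZMod p)} + #{y ∈ A | p < 2 * (z y).val} ≤
      #{y ∈ A | z y ≠ 0} := by
    rw [← card_union_of_disjoint]
    · refine card_le_card fun y hy => ?_
      rw [mem_union, mem_filter, mem_filter] at hy
      rw [mem_filter]
      rcases hy with hy | hy
      · exact ⟨hy.1, by rw [hy.2]; exact hj0⟩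
      · refine ⟨hy.1, fun h => ?_⟩
        rw [h, ZMod.val_zero] at hy
        omega
    · rw [disjoint_filter]
      intro y _ h h'
      rw [h, hv] at h'
      omega
  rcases Nat.eq_zero_or_pos e with rfl | he0
  · rcases Nat.eq_zero_or_pos #{y ∈ A | p < 2 * (z y).val} with h0 | h0
    · omega
    rcases Nat.eq_zero_or_pos #{y ∈ A | z y = (j : ZMod p)} with h0' | h0'
    · omega
    obtain ⟨x, hx⟩ := card_pos.1 h0
    obtain ⟨y, hy⟩ := card_pos.1 h0'
    rw [mem_filter] at hx hy
    have hxy : x ≠ y := by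
      rintro rfl
      rw [hy.2, hv] at hx
      omega
    have hx0 : z x ≠ 0 := by
      intro h
      rw [h, ZMod.val_zero] at hx
      omega
    have h2 : (z x).val + (z y).val ≤ ∑ y ∈ A, (z y).val := by
      rw [← sum_pair (f := fun y => (z y).val) hxy]
      refine sum_le_sum_of_subset ?_
      intro w hw
      rw [mem_insert, mem_singleton] at hw
      rcases hw with rfl | rfl
      · exact hx.1
      · exact hy.1
    rw [hy.2, hv] at h2
    have := hA x hx.1 hx0
    omega
  · omega

/-- Without large lifts every entry is at most j < (p-1)/2, so two entries cannot reach p-1. -/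
lemma three_le_card_add [Fact p.Prime] (A : Finset ι) (z : ι → ZMod p) {e : ℕ}
    (hz : ∑ y ∈ A, z y = -1) (he : ∑ y ∈ A, (z y).val + 1 = p * (e + 1))
    {j : ℕ} (hjp : 2 * j + 1 < p)
    (hA : ∀ y ∈ A, z y ≠ 0 → (z y).val ≤ j ∨ p ≤ (z y).val + j) :
    3 ≤ #{y ∈ A | z y ≠ 0} + #{y ∈ A | z y = -1} + #{y ∈ A | p < 2 * (z y).val} := by
  have h1 := two_le_card_add A z hz he
  rcases Nat.eq_zero_or_pos #{y ∈ A | p < 2 * (z y).val} with h0 | h0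
  · rw [card_eq_zero, filter_eq_empty_iff] at h0
    have h2 := sum_val_le_mul_card A z j fun y hy hy0 => by
      have := hA y hy hy0
      have := h0 hy
      omega
    by_contra! h
    have h3 : #{y ∈ A | z y ≠ 0} * j ≤ 2 * j := Nat.mul_le_mul_right _ (by omega)
    have h4 : p ≤ p * (e + 1) := Nat.le_mul_of_pos_right _ (by omega)
    omega
  · omega

end ZeroSum

/-! ### Pencils, orthogonality to lines, and value counts. -/

open scoped Classical in
/-- The points of `l` other than `x`. -/
noncomputable def otherPoints {P : Type*} {L : Type*} [Fintype P] [Membership P L] (x : P)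
    (l : L) : Finset P := {y | y ∈ l ∧ y ≠ x}

open scoped Classical in
/-- The lines through `x`. -/
noncomputable def pencil {P : Type*} (L : Type*) [Fintype L] [Membership P L] (x : P) :
    Finset L := {l | x ∈ l}

section Pencil

variable {P : Type*} {L : Type*} [Membership P L]

@[simp] lemma mem_otherPoints [Fintype P] {x y : P} {l : L} : y ∈ otherPoints x l ↔ y ∈ l ∧ y ≠ x := by
  simp [otherPoints]

@[simp] lemma mem_pencil [Fintype L] {x : P} {l : L} : l ∈ pencil L x ↔ x ∈ l := by
  simp [pencil]

variable [Fintype P] [Fintype L] [ProjectivePlane P L]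

lemma sum_pencil [DecidableEq P] {M : Type*} [AddCommMonoid M] (x : P) (F : P → M) :
    ∑ l ∈ pencil L x, ∑ y ∈ otherPoints x l, F y = ∑ y ∈ univ.erase x, F y := by
  rw [← sum_biUnion]
  · refine sum_congr ?_ fun _ _ => rfl
    ext y
    simp only [mem_biUnion, mem_pencil, mem_otherPoints, mem_erase, mem_univ, and_true]
    constructor
    · rintro ⟨l, -, -, h⟩
      exact h
    · intro h
      exact ⟨HasLines.mkLine h, (HasLines.mkLine_ax h).2, (HasLines.mkLine_ax h).1, h⟩
  · intro l hl m hm hlm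
    rw [Function.onFun, disjoint_left]
    intro y hy hy'
    rw [mem_otherPoints] at hy hy'
    simp only [mem_coe, mem_pencil] at hl hm
    exact hlm ((Nondegenerate.eq_or_eq hy.1 hl hy'.1 hm).resolve_left hy.2)

lemma sum_card_pencil [DecidableEq P] (x : P) (q : P → Prop) [DecidablePred q] :
    ∑ l ∈ pencil L x, #{y ∈ otherPoints x l | q y} = #(({y | q y} : Finset P).erase x) := by
  simp only [card_filter]
  rw [sum_pencil, ← card_filter]
  congr 1
  ext y
  simp

lemma card_pencil (x : P) : #(pencil L x) = ProjectivePlane.order P L + 1 := by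
  classical
  rw [← ProjectivePlane.lineCount_eq (L := L) x, lineCount, Nat.card_eq_fintype_card,
    Fintype.card_subtype, pencil]

end Pencil

/-- `c` is orthogonal to the incidence vector of every line. -/
def IsOrthogonalToLines {P : Type*} (L : Type*) [Fintype P] [Membership P L] {F : Type*}
    [CommRing F] (c : P → F) : Prop := by
  classical
  exact ∀ l : L, ∑ y with y ∈ l, c y = 0

section Word

variable {P : Type*} {L : Type*} [Fintype P] [Membership P L] {F : Type*} [CommRing F]

open scoped Classical in
lemma dotProduct_incidenceVector (c : P → F) (S : Set P) :
    c ⬝ᵥ incidenceVector F S = ∑ y with y ∈ S, c y := by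
  simp [dotProduct, incidenceVector, Set.indicator_apply, sum_filter]

lemma mem_dualCode_code_iff (c : P → F) :
    c ∈ dualCode (code P L F) ↔ IsOrthogonalToLines L c := by
  classical
  have h1 : ∀ l : L, c ⬝ᵥ incidenceVector F {x : P | x ∈ l} = ∑ y with y ∈ l, c y := fun l => by
    rw [dotProduct_incidenceVector]
    simp
  constructor
  · intro h l
    have := h _ (Submodule.subset_span ⟨l, rfl⟩)
    rw [h1] at this
    convert this
  · intro h v hv
    refine Submodule.span_induction (p := fun v _ => c ⬝ᵥ v = 0) ?_ ?_ ?_ ?_ hv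
    · rintro _ ⟨l, rfl⟩
      rw [h1]
      convert h l
    · exact dotProduct_zero c
    · intro a b _ _ ha hb
      rw [dotProduct_add, ha, hb, add_zero]
    · intro r a _ ha
      rw [dotProduct_smul, ha, smul_zero]

lemma IsOrthogonalToLines.smul {c : P → F} (h : IsOrthogonalToLines L c) (r : F) :
    IsOrthogonalToLines L (r • c) := by
  intro l
  have := h l
  simp only [Pi.smul_apply, ← smul_sum]
  rw [this, smul_zero]

lemma IsOrthogonalToLines.sum_otherPoints {c : P → F} (h : IsOrthogonalToLines L c) {x : P}
    {l : L} (hx : x ∈ l) : ∑ y ∈ otherPoints x l, c y = - c x := by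
  classical
  have h1 := h l
  rw [← add_sum_erase _ _ (show x ∈ ({y | y ∈ l} : Finset P) by simpa using hx)] at h1
  rw [← sub_eq_zero, sub_neg_eq_add, add_comm]
  convert h1 using 3
  ext y
  rw [mem_otherPoints, mem_erase, mem_filter, and_comm]
  simp

end Word

/-- The number of points at which `c` takes the value `u`. -/
noncomputable def valueCount {P : Type*} [Fintype P] {F : Type*} [DecidableEq F] (c : P → F)
    (u : F) : ℕ := #{y | c y = u}

lemma valueCount_pos {P : Type*} [Fintype P] {F : Type*} [DecidableEq F]
    {c : P → F} {u : F} : 0 < valueCount c u ↔ ∃ x, c x = u := by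
  simp [valueCount, card_pos, Finset.Nonempty]

section Word

variable {P : Type*} [Fintype P] {F : Type*} [Field F] [DecidableEq F]

lemma valueCount_smul (c : P → F) {r : F} (hr : r ≠ 0) (u : F) :
    valueCount (r • c) (r * u) = valueCount c u := by
  unfold valueCount
  congr 1
  ext y
  simp [hr]

lemma sum_valueCount [Fintype F] (c : P → F) :
    ∑ u with u ≠ 0, valueCount c u = hammingNorm c := by
  unfold valueCount hammingNorm
  rw [card_eq_sum_card_fiberwise (f := c) (t := ({u | u ≠ 0} : Finset F))]
  · refine sum_congr rfl fun u hu => ?_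
    congr 1
    ext y
    simp only [mem_filter, mem_univ, true_and] at hu ⊢
    constructor
    · rintro rfl
      exact ⟨hu, rfl⟩
    · exact fun h => h.2
  · intro y hy
    simpa using hy

lemma hammingNorm_smul_of_ne_zero (c : P → F) {r : F} (hr : r ≠ 0) :
    hammingNorm (r • c) = hammingNorm c := by
  unfold hammingNorm
  congr 1
  ext y
  simp [hr]

end Word

/-! ### Summing the line inequalities over pencils. -/

section Plane

variable {p : ℕ} [Fact p.Prime] {P : Type*} {L : Type*} [Fintype P] [Fintype L]
  [Membership P L] [ProjectivePlane P L]

/-- The sum of the values of `c`, lifted to natural numbers below `p`. -/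
noncomputable def liftSum (c : P → ZMod p) : ℕ := ∑ y, (c y).val

/-- The number of points at which the lifted value of `c` exceeds `p / 2`. -/
noncomputable def largeCount (c : P → ZMod p) : ℕ := #{y | p < 2 * (c y).val}

/-- The counting consequences of summing over the lines through a point of value `1`. The number
`κ` is the total excess over `p` of the lifted line sums. -/
lemma exists_pencil_bounds (h2 : p ≠ 2) {c : P → ZMod p} (hc : IsOrthogonalToLines L c) {x : P}
    (hx : c x = 1) {R : ℕ} (hR : ProjectivePlane.order P L + 1 = R) :
    ∃ κ : ℕ, liftSum c + R = p * (κ + R) + 1 ∧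
      2 * R + κ + 1 ≤ hammingNorm c + valueCount c (-1) ∧
      (∀ i, 2 ≤ i → 2 * i < p → (∀ y, c y ≠ (i - 1 : ℕ)) →
        valueCount c (-(i : ZMod p)) + 2 * R + 1 ≤
          hammingNorm c + valueCount c (-1) + 2 * κ) ∧
      ∀ j, 2 ≤ j → 2 * j < p → (∀ y, c y ≠ 0 → (c y).val ≤ j ∨ p ≤ (c y).val + j) →
        valueCount c (j : ZMod p) + 2 * largeCount c + 1 ≤
            hammingNorm c + valueCount c (-1) + 3 * κ ∧
        (2 * j + 1 < p → 3 * R + 1 ≤ hammingNorm c + valueCount c (-1) + largeCount c) := by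
  classical
  have hp2 : 2 < p := lt_of_le_of_ne (Fact.out : p.Prime).two_le (Ne.symm h2)
  have : Fact (2 < p) := ⟨hp2⟩
  have : Fact (1 < p) := ⟨by omega⟩
  have hz : ∀ l ∈ pencil L x, ∑ y ∈ otherPoints x l, c y = -1 := fun l hl => by
    rw [hc.sum_otherPoints (mem_pencil.1 hl), hx]
  have he : ∀ l : L, ∃ e, l ∈ pencil L x →
      ∑ y ∈ otherPoints x l, (c y).val + 1 = p * (e + 1) := fun l => by
    by_cases hl : l ∈ pencil L x
    · obtain ⟨e, he⟩ := exists_sum_val_add_one_eq _ c (hz l hl)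
      exact ⟨e, fun _ => he⟩
    · exact ⟨0, fun h => absurd h hl⟩
  choose e he using he
  have hcard : #(pencil L x) = R := by rw [card_pencil, hR]
  have hσ : ∑ l ∈ pencil L x, #{y ∈ otherPoints x l | c y ≠ 0} + 1 = hammingNorm c := by
    rw [sum_card_pencil, hammingNorm]
    exact card_erase_add_one (by simp [hx])
  have hval : ∀ v : ZMod p, v ≠ 1 →
      ∑ l ∈ pencil L x, #{y ∈ otherPoints x l | c y = v} = valueCount c v := fun v hv => by
    rw [sum_card_pencil, valueCount, erase_eq_of_notMem]
    simp [hx, Ne.symm hv]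
  have hb : ∑ l ∈ pencil L x, #{y ∈ otherPoints x l | p < 2 * (c y).val} = largeCount c := by
    rw [sum_card_pencil, largeCount, erase_eq_of_notMem]
    simp only [mem_filter, mem_univ, hx, ZMod.val_one, true_and]
    omega
  have hW : ∑ l ∈ pencil L x, ∑ y ∈ otherPoints x l, (c y).val + 1 = liftSum c := by
    rw [sum_pencil, liftSum, ← add_sum_erase univ _ (mem_univ x), hx, ZMod.val_one, add_comm]
  have hm1 := hval (-1) (ZMod.neg_one_ne_one)
  have hRsum : ∀ t : ℕ, ∑ _l ∈ pencil L x, t = R * t := fun t => by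
    rw [sum_const, hcard, smul_eq_mul]
  refine ⟨∑ l ∈ pencil L x, e l, ?_, ?_, ?_, ?_⟩
  · have := sum_congr rfl he
    rw [sum_add_distrib, hRsum, ← mul_sum, sum_add_distrib, hRsum] at this
    rw [← hW, ← Nat.mul_one R]
    linarith
  · have := sum_le_sum fun l hl => two_le_card_add _ c (hz l hl) (he l hl)
    simp only [sum_add_distrib, hRsum, hm1] at this
    linarith
  · intro i hi hip hV
    have := sum_le_sum fun l hl => card_neg_add_two_le _ c (hz l hl) (he l hl) hi hip
      fun y _ => hV y
    simp only [sum_add_distrib, hRsum, hm1, ← mul_sum] at this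
    rw [hval] at this
    · linarith
    · intro h
      have := congrArg ZMod.val h
      rw [val_neg_natCast (by omega) (by omega), ZMod.val_one] at this
      omega
  · intro j hj hjp hV
    constructor
    · have := sum_le_sum fun l hl => card_max_add_two_mul_card_large_le _ c (hz l hl) (he l hl)
        (by omega) hjp fun y _ => hV y
      simp only [sum_add_distrib, hm1, ← mul_sum, hb] at this
      rw [hval] at this
      · linarith
      · intro h
        have := congrArg ZMod.val h
        rw [ZMod.val_cast_of_lt (by omega), ZMod.val_one] at this
        omega
    · intro hjp'
      have := sum_le_sum fun l hl => three_le_card_add _ c (hz l hl) (he l hl) hjp'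
        fun y _ => hV y
      simp only [sum_add_distrib, hRsum, hm1, hb] at this
      linarith

end Plane

section Plane

variable {p : ℕ} [Fact p.Prime] {P : Type*} [Fintype P]

lemma valueCount_neg (c : P → ZMod p) (v : ZMod p) :
    valueCount (-c) v = valueCount c (-v) := by
  unfold valueCount
  congr 1
  ext y
  simp [neg_eq_iff_eq_neg]

lemma liftSum_add_liftSum_neg (c : P → ZMod p) :
    liftSum c + liftSum (-c) = p * hammingNorm c := by
  unfold liftSum hammingNorm
  rw [← sum_add_distrib, mul_comm, ← smul_eq_mul, ← sum_const, sum_filter]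
  refine sum_congr rfl fun y _ => ?_
  split_ifs with h
  · have : NeZero (c y) := ⟨h⟩
    rw [Pi.neg_apply, ZMod.val_neg_of_ne_zero]
    have := ZMod.val_lt (c y)
    omega
  · simp [not_not.1 h]

lemma largeCount_add_largeCount_neg (h2 : p ≠ 2) (c : P → ZMod p) :
    largeCount c + largeCount (-c) = hammingNorm c := by
  classical
  have hodd : Odd p := (Fact.out : p.Prime).odd_of_ne_two h2
  unfold largeCount hammingNorm
  have hval : ∀ y, c y ≠ 0 → (-c y).val = p - (c y).val := fun y h => by
    have : NeZero (c y) := ⟨h⟩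
    exact ZMod.val_neg_of_ne_zero _
  rw [← card_union_of_disjoint]
  · congr 1
    ext y
    simp only [mem_union, mem_filter, mem_univ, true_and, Pi.neg_apply]
    by_cases h : c y = 0
    · simp [h]
    · rw [hval y h]
      have := ZMod.val_lt (c y)
      obtain ⟨q, hq⟩ := hodd
      simp only [ne_eq, h, not_false_eq_true, iff_true]
      omega
  · rw [disjoint_filter]
    intro y _ h1 h3
    by_cases h : c y = 0
    · simp [h] at h1
    · rw [Pi.neg_apply, hval y h] at h3
      have := ZMod.val_lt (c y)
      omega

variable {L : Type*} [Fintype L] [Membership P L] [ProjectivePlane P L]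

/-- The counting consequences of summing over the lines through a point of value `1` and over
the lines through a point of value `-1`. -/
lemma exists_antipodal_bounds (h2 : p ≠ 2) {c : P → ZMod p} (hc : IsOrthogonalToLines L c)
    (hx : ∃ x, c x = 1) (hord : ProjectivePlane.order P L = p ^ 2)
    (hN : hammingNorm c ≤ 2 * p ^ 2 + 2) :
    ∃ κ κ' : ℕ, liftSum c + (p ^ 2 + 1) = p * (κ + (p ^ 2 + 1)) + 1 ∧
      liftSum (-c) + (p ^ 2 + 1) = p * (κ' + (p ^ 2 + 1)) + 1 ∧
      hammingNorm c + 2 * p = 2 * p ^ 2 + 2 + (κ + κ') ∧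
      2 * (p ^ 2 + 1) + κ + 1 ≤ hammingNorm c + valueCount c (-1) ∧
      2 * (p ^ 2 + 1) + κ' + 1 ≤ hammingNorm c + valueCount c 1 ∧
      (∀ i, 2 ≤ i → 2 * i < p → valueCount c (i - 1 : ℕ) = 0 →
        valueCount c (-(i - 1 : ℕ)) = 0 →
        valueCount c i + valueCount c (-i) + 4 * (p ^ 2 + 1) + 2 ≤
          2 * hammingNorm c + (valueCount c 1 + valueCount c (-1)) + 2 * (κ + κ')) ∧
      ∀ j, 2 ≤ j → 2 * j < p → (∀ y, c y ≠ 0 → (c y).val ≤ j ∨ p ≤ (c y).val + j) →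
        valueCount c j + valueCount c (-j) + 2 ≤
            valueCount c 1 + valueCount c (-1) + 3 * (κ + κ') ∧
        (2 * j + 1 < p → 6 * (p ^ 2 + 1) + 2 ≤
          3 * hammingNorm c + (valueCount c 1 + valueCount c (-1))) := by
  obtain ⟨x, hx⟩ := hx
  have hR : ProjectivePlane.order P L + 1 = p ^ 2 + 1 := by rw [hord]
  obtain ⟨κ, h1, h3, h4, h5⟩ := exists_pencil_bounds h2 hc hx hR
  -- The bound `h3` with weight at most 2p²+2 forces the value -1 to occur, so the pencil argument
  -- also applies to `-c`.
  obtain ⟨x', hx'⟩ := valueCount_pos.1 (show 0 < valueCount c (-1) by omega)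
  have hc' : IsOrthogonalToLines L (-c) := by
    have := hc.smul (-1)
    rwa [neg_one_smul] at this
  have hx'' : (-c) x' = 1 := by rw [Pi.neg_apply, hx', neg_neg]
  obtain ⟨κ', h1', h3', h4', h5'⟩ := exists_pencil_bounds h2 hc' hx'' hR
  have hnorm : hammingNorm (-c) = hammingNorm c := by
    rw [← neg_one_smul (ZMod p) c]
    exact hammingNorm_smul_of_ne_zero c (neg_ne_zero.2 one_ne_zero)
  have hH := liftSum_add_liftSum_neg c
  have hB := largeCount_add_largeCount_neg h2 c
  simp only [valueCount_neg, neg_neg, hnorm] at h3' h4' h5'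
  have hp : 0 < p := (Fact.out : p.Prime).pos
  refine ⟨κ, κ', h1, h1', ?_, h3, h3', ?_, ?_⟩
  · refine Nat.eq_of_mul_eq_mul_left hp ?_
    nlinarith
  · intro i hi hip hv hv'
    have e1 := h4 i hi hip fun y hy => by
      exact (valueCount_pos.2 ⟨y, hy⟩).ne' hv
    have e2 := h4' i hi hip fun y hy => by
      refine (valueCount_pos.2 ⟨y, ?_⟩).ne' hv'
      rw [← hy, Pi.neg_apply, neg_neg]
    linarith
  · intro j hj hjp hV
    obtain ⟨e1, e2⟩ := h5 j hj hjp hV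
    obtain ⟨e1', e2'⟩ := h5' j hj hjp fun y hy => by
      have h0 : c y ≠ 0 := by simpa using hy
      have : NeZero (c y) := ⟨h0⟩
      rw [Pi.neg_apply, ZMod.val_neg_of_ne_zero]
      have := ZMod.val_lt (c y)
      have := hV y h0
      omega
    refine ⟨by linarith, fun h => ?_⟩
    have := e2 h
    have := e2' h
    linarith

/-! ### The set of values is one opposite pair or everything. -/

/-- The number of points with value `u` or `-u`. -/
noncomputable def pairCount (c : P → ZMod p) (u : ZMod p) : ℕ :=
  valueCount c u + valueCount c (-u)

lemma valueCount_inv_smul (c : P → ZMod p) {u : ZMod p} (hu : u ≠ 0) (v : ZMod p) :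
    valueCount (u⁻¹ • c) v = valueCount c (u * v) := by
  rw [← valueCount_smul c (inv_ne_zero hu) (u * v), inv_mul_cancel_left₀ hu]

lemma pairCount_inv_smul (c : P → ZMod p) {u : ZMod p} (hu : u ≠ 0) (v : ZMod p) :
    pairCount (u⁻¹ • c) v = pairCount c (u * v) := by
  rw [pairCount, pairCount, valueCount_inv_smul c hu, valueCount_inv_smul c hu, mul_neg]

/-- Rescaling by `u⁻¹` turns `u` into 1; the exact weight formula then converts the pencil bounds
into bounds on multiplicities. -/
lemma valueCount_lower_bound (h2 : p ≠ 2) {c : P → ZMod p} (hc : IsOrthogonalToLines L c)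
    (hord : ProjectivePlane.order P L = p ^ 2) {k : ℕ}
    (hN : hammingNorm c + 2 * p = 2 * p ^ 2 + 2 + k) (hk : k ≤ 2 * p) {u : ZMod p} (hu : u ≠ 0)
    (hm : 0 < valueCount c u) :
    2 * p + 1 ≤ valueCount c u + k ∧ 2 * p + 1 ≤ valueCount c (-u) + k ∧
      4 * p + 2 ≤ pairCount c u + k := by
  obtain ⟨κ, κ', -, -, h1, h3, h4, -⟩ := exists_antipodal_bounds (L := L) (c := u⁻¹ • c) h2
    (hc.smul _) (valueCount_pos.1 (by rw [valueCount_inv_smul c hu]; simpa using hm)) hord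
    (by rw [hammingNorm_smul_of_ne_zero c (inv_ne_zero hu)]; omega)
  rw [hammingNorm_smul_of_ne_zero c (inv_ne_zero hu)] at h1 h3 h4
  rw [valueCount_inv_smul c hu, mul_one] at h4
  rw [valueCount_inv_smul c hu, mul_neg, mul_one] at h3
  rw [pairCount]
  omega

/-- If u(i-1) were missing, then so would be its negative, and the summed inequality would make the
pair of ui rarer than that of u by at least 4p+2-4k. The tolerance 4 in `hmin` is harmless and is
needed to reuse the lemma for the largest value. -/
lemma valueCount_pred_pos (hp7 : 7 ≤ p) {c : P → ZMod p} (hc : IsOrthogonalToLines L c)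
    (hord : ProjectivePlane.order P L = p ^ 2) {k : ℕ}
    (hN : hammingNorm c + 2 * p = 2 * p ^ 2 + 2 + k) (hk : k ≤ 2) {u : ZMod p} (hu : u ≠ 0)
    (hm : 0 < valueCount c u)
    (hmin : ∀ v, v ≠ 0 → 0 < valueCount c v → pairCount c u ≤ pairCount c v + 4)
    {i : ℕ} (hi : 2 ≤ i) (hip : 2 * i < p) (him : 0 < valueCount c (u * i)) :
    0 < valueCount c (u * (i - 1 : ℕ)) := by
  have h2 : p ≠ 2 := by omega
  have hnat : ∀ t : ℕ, 0 < t → t < p → u * (t : ZMod p) ≠ 0 := fun t ht htp h => by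
    rcases mul_eq_zero.1 h with h | h
    · exact hu h
    · rw [CharP.cast_eq_zero_iff (ZMod p) p] at h
      exact absurd (Nat.le_of_dvd ht h) (by omega)
  by_contra h0
  have h0' : valueCount c (u * (i - 1 : ℕ)) = 0 := by omega
  have h0'' : valueCount c (-(u * (i - 1 : ℕ))) = 0 := by
    by_contra h
    have := valueCount_lower_bound (L := L) h2 hc hord hN (by omega)
      (neg_ne_zero.2 (hnat (i - 1) (by omega) (by omega))) (Nat.pos_of_ne_zero h)
    rw [neg_neg] at this
    omega
  obtain ⟨κ, κ', -, -, h1, -, -, h5, -⟩ := exists_antipodal_bounds (L := L) (c := u⁻¹ • c) h2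
    (hc.smul _) (valueCount_pos.1 (by rw [valueCount_inv_smul c hu]; simpa using hm)) hord
    (by rw [hammingNorm_smul_of_ne_zero c (inv_ne_zero hu)]; omega)
  have h6 := h5 i hi hip
  rw [hammingNorm_smul_of_ne_zero c (inv_ne_zero hu)] at h1 h6
  simp only [valueCount_inv_smul c hu, mul_neg, mul_one] at h6
  have h7 := h6 h0' h0''
  have h8 := hmin _ (hnat i (by omega) (by omega)) him
  simp only [pairCount] at h8
  omega

/-- The classes {i, -i} for i ≤ j < p/2 are disjoint, being told apart by the absolutely least
residue. -/
lemma mul_le_hammingNorm (c : P → ZMod p) {j M : ℕ} (hjp : 2 * j < p)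
    (h : ∀ i : ℕ, 0 < i → i ≤ j → M ≤ pairCount c i) : j * M ≤ hammingNorm c := by
  classical
  have habs : ∀ i : ℕ, 0 < i → i ≤ j → ∀ y : P, c y = i ∨ c y = -i →
      (c y).valMinAbs.natAbs = i := fun i hi hij y hy => by
    have : ((i : ZMod p)).valMinAbs.natAbs = i := by
      rw [ZMod.valMinAbs_natCast_of_le_half (by omega), Int.natAbs_natCast]
    rcases hy with hy | hy
    · rw [hy, this]
    · rw [hy, ZMod.natAbs_valMinAbs_neg, this]
  have hcard : ∀ i : ℕ, 0 < i → i ≤ j →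
      #{y | c y = (i : ZMod p) ∨ c y = -(i : ZMod p)} = pairCount c i := fun i hi hij => by
    rw [filter_or, card_union_of_disjoint]
    · rfl
    · rw [disjoint_filter]
      intro y _ h1 h2
      have h3 : ((i : ZMod p)).val = (-(i : ZMod p)).val :=
        congrArg ZMod.val (h1.symm.trans h2)
      rw [ZMod.val_cast_of_lt (by omega), val_neg_natCast hi (by omega)] at h3
      omega
  calc j * M = ∑ _i ∈ Icc 1 j, M := by simp
    _ ≤ ∑ i ∈ Icc 1 j, #{y | c y = (i : ZMod p) ∨ c y = -(i : ZMod p)} :=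
        sum_le_sum fun i hi => by
          rw [mem_Icc] at hi
          rw [hcard i hi.1 hi.2]
          exact h i hi.1 hi.2
    _ = #((Icc 1 j).biUnion fun i => {y | c y = (i : ZMod p) ∨ c y = -(i : ZMod p)}) := by
        rw [card_biUnion]
        intro i hi i' hi' hne
        rw [mem_coe, mem_Icc] at hi hi'
        rw [Function.onFun, disjoint_filter]
        intro y _ h1 h2
        exact hne ((habs i hi.1 hi.2 y h1).symm.trans (habs i' hi'.1 hi'.2 y h2))
    _ ≤ hammingNorm c := by
        refine card_le_card fun y hy => ?_
        simp only [mem_biUnion, mem_Icc, mem_filter, mem_univ, true_and] at hy ⊢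
        obtain ⟨i, hi, h'⟩ := hy
        intro h0
        have := habs i hi.1 hi.2 y h'
        rw [h0, ZMod.valMinAbs_zero, Int.natAbs_zero] at this
        omega

/-- The dichotomy `two_values_or_all_values` for a word for which the pair `{1, -1}` is attained
least often. -/
lemma two_values_or_all_values_of_min (hp7 : 7 ≤ p) {k : ℕ} (hk : k ≤ 2)
    (hord : ProjectivePlane.order P L = p ^ 2) {c : P → ZMod p} (hc : IsOrthogonalToLines L c)
    (hN : hammingNorm c + 2 * p = 2 * p ^ 2 + 2 + k) (h1 : 0 < valueCount c 1)
    (hmin : ∀ v, v ≠ 0 → 0 < valueCount c v → pairCount c 1 ≤ pairCount c v) :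
    (∀ y, c y ≠ 0 → c y = 1 ∨ c y = -1) ∨ ∀ u, u ≠ 0 → 0 < valueCount c u := by
  have h2 : p ≠ 2 := by omega
  have hlow := fun {u : ZMod p} => valueCount_lower_bound (L := L) (u := u) h2 hc hord hN (by omega)
  have hneg : ∀ u, u ≠ 0 → 0 < valueCount c u → 0 < valueCount c (-u) := fun u hu hm => by
    have := hlow hu hm
    omega
  have hnat : ∀ t : ℕ, 0 < t → t < p → (t : ZMod p) ≠ 0 := fun t ht htp h => by
    rw [CharP.cast_eq_zero_iff (ZMod p) p] at h
    exact absurd (Nat.le_of_dvd ht h) (by omega)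
  have hodd : ∃ q, p = 2 * q + 1 := (Fact.out : p.Prime).odd_of_ne_two h2
  -- representatives of the values below `p / 2`
  have hrep : ∀ u : ZMod p, u ≠ 0 → ∃ i : ℕ, 0 < i ∧ 2 * i < p ∧ (u = i ∨ u = -i) ∧
      (u.val = i ∨ u.val + i = p) := fun u hu => by
    have hlt := ZMod.val_lt u
    have hpos := ZMod.val_pos.2 hu
    obtain ⟨q, hq⟩ := hodd
    by_cases h : 2 * u.val < p
    · exact ⟨u.val, hpos, h, Or.inl (ZMod.natCast_zmod_val u).symm, Or.inl rfl⟩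
    · refine ⟨p - u.val, by omega, by omega, Or.inr ?_, Or.inr (by omega)⟩
      rw [Nat.cast_sub hlt.le]
      simp
  let J : Finset ℕ := {i ∈ range p | 0 < i ∧ 2 * i < p ∧ 0 < valueCount c (i : ZMod p)}
  have hJ : ∀ i, i ∈ J ↔ 0 < i ∧ 2 * i < p ∧ 0 < valueCount c (i : ZMod p) := fun i => by
    simp only [J, mem_filter, mem_range]
    omega
  have hJ1 : 1 ∈ J := by
    rw [hJ]
    exact ⟨one_pos, by omega, by simpa using h1⟩
  obtain ⟨j, hj, hjmax⟩ := exists_max_image J id ⟨1, hJ1⟩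
  simp only [id] at hjmax
  have hj1 := hjmax 1 hJ1
  rw [hJ] at hj
  obtain ⟨-, hjp, hjm⟩ := hj
  have hV : ∀ u, u ≠ 0 → 0 < valueCount c u → ∃ i, 0 < i ∧ i ≤ j ∧ (u = i ∨ u = -i) ∧
      (u.val = i ∨ u.val + i = p) := fun u hu hm => by
    obtain ⟨i, hi, hip, h, h'⟩ := hrep u hu
    refine ⟨i, hi, hjmax i ?_, h, h'⟩
    rw [hJ]
    refine ⟨hi, hip, ?_⟩
    rcases h with rfl | rfl
    · exact hm
    · have := hneg _ hu hm
      rwa [neg_neg] at this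
  have hVj : ∀ y, c y ≠ 0 → (c y).val ≤ j ∨ p ≤ (c y).val + j := fun y hy => by
    obtain ⟨i, hi, hij, -, h⟩ := hV (c y) hy (valueCount_pos.2 ⟨y, rfl⟩)
    omega
  rcases hj1.eq_or_lt with rfl | hj2
  · left
    intro y hy
    obtain ⟨i, hi, hij, h, -⟩ := hV (c y) hy (valueCount_pos.2 ⟨y, rfl⟩)
    have : i = 1 := by omega
    subst this
    simpa using h
  right
  obtain ⟨κ, κ', -, -, hκ, -, -, -, h5⟩ := exists_antipodal_bounds (L := L) h2 hc
    (valueCount_pos.1 h1) hord (by omega)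
  obtain ⟨hQ3, hQ4⟩ := h5 j hj2 hjp hVj
  have hdesc : ∀ u : ZMod p, u ≠ 0 → 0 < valueCount c u →
      (∀ v, v ≠ 0 → 0 < valueCount c v → pairCount c u ≤ pairCount c v + 4) →
      ∀ i : ℕ, 2 * i < p → 0 < valueCount c (u * i) → ∀ i', 0 < i' → i' ≤ i →
        0 < valueCount c (u * i') := fun u hu hm hmin i hip him i' hi' hle => by
    induction i, hle using Nat.le_induction with
    | base => exact him
    | succ i hle ih =>
      refine ih (by omega) ?_
      have := valueCount_pred_pos (L := L) hp7 hc hord hN hk hu hm hmin (i := i + 1) (by omega) hip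
        him
      simpa using this
  have hall : ∀ i : ℕ, 0 < i → i ≤ j → 0 < valueCount c (i : ZMod p) := fun i hi hij => by
    have := hdesc 1 one_ne_zero h1 (fun v hv hm => (hmin v hv hm).trans (by omega)) j hjp
      (by simpa using hjm) i hi hij
    simpa using this
  have hj0 := hnat j (by omega) (by omega)
  -- `hQ3` bounds the pair of j by that of 1 plus 3k-2 ≤ 4, whence the tolerance 4.
  have hminj : ∀ v, v ≠ 0 → 0 < valueCount c v → pairCount c j ≤ pairCount c v + 4 :=
    fun v hv hm => by
      have h := hmin v hv hm
      rw [pairCount, pairCount] at *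
      omega
  -- the values are also an interval when measured in multiples of `j`
  have h2j : 0 < valueCount c ((j : ZMod p) * (2 : ℕ)) := by
    obtain ⟨i, hi, hip, h, -⟩ := hrep (j : ZMod p)⁻¹ (inv_ne_zero hj0)
    have hji : (j : ZMod p) * i = 1 ∨ (j : ZMod p) * i = -1 := by
      rcases h with h | h
      · left
        rw [← h, mul_inv_cancel₀ hj0]
      · right
        rw [← neg_neg (i : ZMod p), ← h, mul_neg, mul_inv_cancel₀ hj0]
    have him : 0 < valueCount c ((j : ZMod p) * i) := by
      rcases hji with h | h
      · rw [h]
        exact h1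
      · rw [h]
        exact hneg 1 one_ne_zero h1
    -- The value ±1 is the i-th multiple of j, so the descent reaches 2j unless i = 1. But i = 1
    -- means j = ±1, impossible for 2 ≤ j < p/2.
    refine hdesc j hj0 hjm hminj i hip him 2 two_pos ?_
    by_contra hlt
    have : i = 1 := by omega
    subst this
    rw [Nat.cast_one, mul_one] at hji
    rcases hji with h | h
    · have : Fact (1 < p) := ⟨by omega⟩
      have := congrArg ZMod.val h
      rw [ZMod.val_cast_of_lt (by omega), ZMod.val_one] at this
      omega
    · have := congrArg ZMod.val h
      have h' := val_neg_natCast (p := p) (i := 1) one_pos (by omega)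
      rw [Nat.cast_one] at h'
      rw [ZMod.val_cast_of_lt (by omega), h'] at this
      omega
  -- The value 2j exceeds j, so it must be one of the negative values: p - 2j ≤ j.
  have h3j : p ≤ 3 * j := by
    rw [← Nat.cast_mul] at h2j
    obtain ⟨i, hi, hij, -, h⟩ := hV _ (hnat (j * 2) (by omega) (by omega)) h2j
    rw [ZMod.val_cast_of_lt (by omega)] at h
    omega
  -- Otherwise `hQ4` gives every pair multiplicity at least 6p-4, and the j ≥ p/3 pairs together
  -- outweigh the word.
  have hjtop : 2 * j + 1 = p := by
    by_contra hne
    have hQ := hQ4 (by omega)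
    have hcount : j * pairCount c 1 ≤ hammingNorm c := mul_le_hammingNorm c hjp fun i hi hij =>
      hmin _ (hnat i hi (by omega)) (hall i hi hij)
    have h6 : 6 * p ≤ pairCount c 1 + 4 := by
      rw [pairCount]
      omega
    have h7 : j * (6 * p) ≤ j * (pairCount c 1 + 4) := Nat.mul_le_mul_left j h6
    have h8 : p * (6 * p) ≤ 3 * j * (6 * p) := Nat.mul_le_mul_right _ h3j
    have h9 : 2 * p ^ 2 ≤ hammingNorm c + 4 * j := by nlinarith
    omega
  intro u hu
  obtain ⟨i, hi, hip, h, -⟩ := hrep u hu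
  have := hall i hi (by omega)
  rcases h with rfl | rfl
  · exact this
  · exact hneg _ (neg_ne_zero.1 hu) this

/-- In a word of small weight, either only two opposite nonzero values occur, or all of them. -/
lemma two_values_or_all_values (hp7 : 7 ≤ p) {c : P → ZMod p} (hc : IsOrthogonalToLines L c)
    (hord : ProjectivePlane.order P L = p ^ 2) {k : ℕ}
    (hN : hammingNorm c + 2 * p = 2 * p ^ 2 + 2 + k) (hk : k ≤ 2) :
    (∃ u, u ≠ 0 ∧ (∃ x, c x = u) ∧ ∀ y, c y ≠ 0 → c y = u ∨ c y = -u) ∨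
      ∀ u, u ≠ 0 → 0 < valueCount c u := by
  have hne : ({u | u ≠ 0 ∧ 0 < valueCount c u} : Finset (ZMod p)).Nonempty := by
    by_contra h
    rw [not_nonempty_iff_eq_empty] at h
    have h0 : hammingNorm c = 0 := by
      rw [hammingNorm_eq_zero]
      ext y
      by_contra hy
      have : c y ∈ ({u | u ≠ 0 ∧ 0 < valueCount c u} : Finset (ZMod p)) := by
        simp only [mem_filter, mem_univ, true_and]
        exact ⟨hy, valueCount_pos.2 ⟨y, rfl⟩⟩
      rw [h] at this
      simp at this
    nlinarith
  obtain ⟨u, hu, hmin⟩ := exists_min_image _ (pairCount c) hne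
  simp only [mem_filter, mem_univ, true_and] at hu hmin
  obtain ⟨hu0, hu⟩ := hu
  have huc : ∀ v, valueCount (u⁻¹ • c) (u⁻¹ * v) = valueCount c v := fun v =>
    valueCount_smul c (inv_ne_zero hu0) v
  rcases two_values_or_all_values_of_min (L := L) (c := u⁻¹ • c) hp7 hk hord (hc.smul _)
    (by rw [hammingNorm_smul_of_ne_zero c (inv_ne_zero hu0)]; exact hN)
    (by rw [valueCount_inv_smul c hu0]; simpa using hu)
    (fun v hv hvm => by
      rw [pairCount_inv_smul c hu0, pairCount_inv_smul c hu0, mul_one]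
      rw [valueCount_inv_smul c hu0] at hvm
      exact hmin _ ⟨mul_ne_zero hu0 hv, hvm⟩) with h | h
  · refine Or.inl ⟨u, hu0, valueCount_pos.1 hu, fun y hy => ?_⟩
    rcases h y (by simpa [hu0] using hy) with h | h
    · left
      rw [Pi.smul_apply, smul_eq_mul, inv_mul_eq_iff_eq_mul₀ hu0, mul_one] at h
      exact h
    · right
      rw [Pi.smul_apply, smul_eq_mul, inv_mul_eq_iff_eq_mul₀ hu0, mul_neg, mul_one] at h
      exact h
  · refine Or.inr fun v hv => ?_
    rw [← huc]
    exact h _ (mul_ne_zero (inv_ne_zero hu0) hv)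

end Plane

/-! ### Pairs of prescribed ratio in a zero-sum family. -/

section RatioCount

lemma sum_comp_eq_sum_card_mul {F : Type*} [DecidableEq F] [Fintype F] {ι : Type*} (A : Finset ι)
    (z : ι → F) (f : F → ℤ) :
    ∑ x ∈ A, f (z x) = ∑ u, (#{y ∈ A | z y = u} : ℤ) * f u := by
  rw [← sum_fiberwise A z]
  refine sum_congr rfl fun u _ => ?_
  rw [← nsmul_eq_mul, ← sum_const]
  refine sum_congr rfl fun x hx => ?_
  rw [(mem_filter.1 hx).2]

variable {F : Type*} [Field F] [DecidableEq F] {ι : Type*}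

/-- The number of ordered pairs of elements of `A` whose values have ratio `r`. -/
def ratioCount (A : Finset ι) (z : ι → F) (r : F) : ℕ :=
  ∑ x ∈ A, #{y ∈ A | z y = r * z x}

lemma ratioCount_eq_sum [Fintype F] (A : Finset ι) (z : ι → F) (r : F) :
    (ratioCount A z r : ℤ) = ∑ u, (#{y ∈ A | z y = u} : ℤ) * #{y ∈ A | z y = r * u} := by
  rw [ratioCount, Nat.cast_sum]
  exact sum_comp_eq_sum_card_mul A z fun u => (#{y ∈ A | z y = r * u} : ℤ)

/-- With multiplicities n(u), this is 2n(u)n(ru) ≤ n(u)² + n(ru)² summed over u, since u ↦ ru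
permutes the field. -/
lemma ratioCount_le [Fintype F] (A : Finset ι) (z : ι → F) {r : F} (hr : r ≠ 0) :
    ratioCount A z r ≤ ratioCount A z 1 := by
  zify
  rw [ratioCount_eq_sum, ratioCount_eq_sum]
  simp only [one_mul]
  set n : F → ℤ := fun u => #{y ∈ A | z y = u} with hn
  have h : ∑ u, n (r * u) * n (r * u) = ∑ u, n u * n u :=
    Equiv.sum_comp (Equiv.mulLeft₀ r hr) fun u => n u * n u
  have h' : ∑ u, 2 * (n u * n (r * u)) ≤ ∑ u, (n u * n u + n (r * u) * n (r * u)) :=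
    sum_le_sum fun u _ => by nlinarith [sq_nonneg (n u - n (r * u))]
  rw [sum_add_distrib, h, ← mul_sum] at h'
  linarith

lemma ratioCount_eq_sum_ite (A : Finset ι) (z : ι → F) (r : F) :
    ratioCount A z r = ∑ x ∈ A, ∑ y ∈ A, if z y = r * z x then 1 else 0 := by
  simp only [ratioCount, card_filter]

lemma card_le_ratioCount_one (A : Finset ι) (z : ι → F) : #A ≤ ratioCount A z 1 := by
  rw [ratioCount, card_eq_sum_ones]
  refine sum_le_sum fun x hx => ?_
  exact card_pos.2 ⟨x, by simp [hx]⟩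

/-- Multiplication by -2 cannot keep three of the four elements in `B`, by comparing sums, nor all
four, by comparing products: that would give 16 = 1. -/
lemma card_filter_neg_two_mul_mem_le (h3 : (3 : F) ≠ 0) (h5 : (5 : F) ≠ 0) (h2 : (2 : F) ≠ 0)
    {B : Finset F} (hB : #B = 4) (hsum : ∑ u ∈ B, u = 0) (h0 : (0 : F) ∉ B) :
    #{u ∈ B | -2 * u ∈ B} ≤ 2 := by
  have hinj : Function.Injective fun u : F => -2 * u := mul_right_injective₀ (neg_ne_zero.2 h2)
  by_contra! hlt
  set D := {u ∈ B | -2 * u ∈ B} with hD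
  have hDB : D ⊆ B := filter_subset _ _
  have hED : D.image (fun u => -2 * u) ⊆ B := by
    intro w hw
    obtain ⟨u, hu, rfl⟩ := mem_image.1 hw
    exact (mem_filter.1 hu).2
  have hEc : #(D.image fun u => -2 * u) = #D := card_image_of_injective D hinj
  have hle := card_le_card hDB
  have hcase : #D = 3 ∨ #D = 4 := by omega
  rcases hcase with h | h
  · obtain ⟨y, hy⟩ := card_eq_one.1 (show #(B \ D) = 1 by rw [card_sdiff_of_subset hDB]; omega)
    obtain ⟨w, hw⟩ := card_eq_one.1
      (show #(B \ D.image fun u => -2 * u) = 1 by rw [card_sdiff_of_subset hED]; omega)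
    have e1 := sum_sdiff (f := fun u => u) hDB
    have e2 := sum_sdiff (f := fun u => u) hED
    rw [hy, sum_singleton, hsum] at e1
    rw [hw, sum_singleton, hsum, sum_image hinj.injOn, ← mul_sum] at e2
    -- The element missed by the image is -2 times the element left out of `D`, so that element
    -- belongs to `D` after all.
    have hwy : w = -2 * y := by linear_combination e2 + 2 * e1
    have hyB : y ∈ B \ D := by rw [hy]; simp
    have hwB : w ∈ B \ D.image fun u => -2 * u := by rw [hw]; simp
    rw [mem_sdiff] at hyB hwB
    refine hyB.2 (mem_filter.2 ⟨hyB.1, ?_⟩)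
    rw [← hwy]
    exact hwB.1
  · have hDe : D = B := eq_of_subset_of_card_le hDB (by omega)
    have hEe : D.image (fun u => -2 * u) = B := eq_of_subset_of_card_le hED (by omega)
    have hprod : ∏ u ∈ B, u = ∏ u ∈ B, (-2 * u) := by
      conv_lhs => rw [← hEe]
      rw [prod_image hinj.injOn, hDe]
    rw [prod_mul_distrib, prod_const, hB] at hprod
    have hne : ∏ u ∈ B, u ≠ 0 := prod_ne_zero_iff.2 fun u hu hu0 => h0 (hu0 ▸ hu)
    have : (3 * 5 : F) * ∏ u ∈ B, u = 0 := by linear_combination -hprod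
    exact (mul_ne_zero (mul_ne_zero h3 h5) hne) this

/-- For distinct values this is `card_filter_neg_two_mul_mem_le`. A repeated value adds at least two
pairs of ratio 1, and 2a + b + d = 0 then excludes most pairs of ratio -2. -/
lemma ratioCount_four (h3 : (3 : F) ≠ 0) (h5 : (5 : F) ≠ 0) (h2 : (2 : F) ≠ 0) {A : Finset ι}
    {z : ι → F} (hA : #A = 4) (hz : ∑ x ∈ A, z x = 0) (h0 : ∀ x ∈ A, z x ≠ 0) :
    ratioCount A z (-2) + 2 ≤ ratioCount A z 1 := by
  classical
  have h1 := card_le_ratioCount_one A z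
  by_cases hinj : Set.InjOn z A
  · have hB := card_filter_neg_two_mul_mem_le h3 h5 h2 (B := A.image z)
      (by rw [card_image_of_injOn hinj, hA]) (by rw [sum_image hinj, hz])
      (by
        intro h
        obtain ⟨x, hx, hx0⟩ := mem_image.1 h
        exact h0 x hx hx0)
    suffices ratioCount A z (-2) ≤ #{u ∈ A.image z | -2 * u ∈ A.image z} by omega
    rw [card_filter, sum_image hinj, ratioCount]
    refine sum_le_sum fun x hx => ?_
    split_ifs with h
    · refine card_le_one.2 fun y hy y' hy' => ?_
      rw [mem_filter] at hy hy'
      exact hinj hy.1 hy'.1 (hy.2.trans hy'.2.symm)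
    · rw [Nat.le_zero, card_eq_zero, filter_eq_empty_iff]
      intro y hy hyx
      exact h (mem_image.2 ⟨y, hy, hyx⟩)
  · rw [Set.InjOn] at hinj
    push Not at hinj
    obtain ⟨x, hx, y, hy, hxy, hne⟩ := hinj
    rw [mem_coe] at hx hy
    have hyx : y ∈ A.erase x := mem_erase.2 ⟨hne.symm, hy⟩
    obtain ⟨w, v, hwv, hA'⟩ := card_eq_two.1 (show #((A.erase x).erase y) = 2 by
      rw [card_erase_of_mem hyx, card_erase_of_mem hx, hA])
    have hAe : A = insert x (insert y {w, v}) := by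
      rw [← hA', insert_erase hyx, insert_erase hx]
    have hwv' : w ∈ (A.erase x).erase y ∧ v ∈ (A.erase x).erase y := by rw [hA']; simp
    have hx' : x ∉ (insert y {w, v} : Finset ι) := by
      rw [← hA', insert_erase hyx]; simp
    have hy' : y ∉ ({w, v} : Finset ι) := by rw [← hA']; simp
    have hw' : w ∉ ({v} : Finset ι) := by simpa using hwv
    have hw0 := h0 w (mem_of_mem_erase (mem_of_mem_erase hwv'.1))
    have hv0 := h0 v (mem_of_mem_erase (mem_of_mem_erase hwv'.2))
    have hx0 := h0 x hx
    rw [ratioCount_eq_sum_ite, ratioCount_eq_sum_ite]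
    rw [hAe] at hz ⊢
    simp only [sum_insert hx', sum_insert hy', sum_insert hw', sum_singleton] at hz ⊢
    rw [← hxy] at hz ⊢
    generalize z x = a at *
    generalize z w = b at *
    generalize z v = d at *
    have e1 : a ≠ -2 * a := fun h => mul_ne_zero h3 hx0 (by linear_combination h)
    have e2 : b ≠ -2 * b := fun h => mul_ne_zero h3 hw0 (by linear_combination h)
    have e3 : d ≠ -2 * d := fun h => mul_ne_zero h3 hv0 (by linear_combination h)
    have e4 : b ≠ -2 * a := fun h => hv0 (by linear_combination hz - h)
    have e5 : d ≠ -2 * a := fun h => hw0 (by linear_combination hz - h)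
    have e6 : ¬(a = -2 * b ∧ a = -2 * d) := fun h =>
      mul_ne_zero h2 hx0 (by linear_combination 2 * hz - h.1 - h.2)
    have t1 : (if b = -2 * d then 1 else 0) ≤ 1 := by split_ifs <;> simp
    have t2 : (if d = -2 * b then 1 else 0) ≤ 1 := by split_ifs <;> simp
    rw [if_neg e1, if_neg e2, if_neg e3, if_neg e4, if_neg e5]
    clear * - e6 t1 t2
    simp only [one_mul, if_true]
    by_cases c1 : a = -2 * b
    · rw [if_pos c1, if_neg fun h => e6 ⟨c1, h⟩]
      omega
    · rw [if_neg c1]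
      by_cases c2 : a = -2 * d
      · rw [if_pos c2]
        omega
      · rw [if_neg c2]
        omega

/-- If a + b + d = 0, then b = -2a exactly when d = a. So pairs of ratio -2 match the off-diagonal
pairs of equal value. -/
lemma ratioCount_three (h3 : (3 : F) ≠ 0) {A : Finset ι}
    {z : ι → F} (hA : #A = 3) (hz : ∑ x ∈ A, z x = 0) (h0 : ∀ x ∈ A, z x ≠ 0) :
    ratioCount A z (-2) + 3 = ratioCount A z 1 := by
  classical
  obtain ⟨x, y, w, hxy, hxw, hyw, rfl⟩ := card_eq_three.1 hA
  have hx0 := h0 x (by simp)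
  have hy0 := h0 y (by simp)
  have hw0 := h0 w (by simp)
  have hx' : x ∉ ({y, w} : Finset ι) := by simp [hxy, hxw]
  have hy' : y ∉ ({w} : Finset ι) := by simpa using hyw
  rw [ratioCount_eq_sum_ite, ratioCount_eq_sum_ite]
  simp only [sum_insert hx', sum_insert hy', sum_singleton] at hz ⊢
  generalize z x = a at *
  generalize z y = b at *
  generalize z w = d at *
  have e1 : a ≠ -2 * a := fun h => mul_ne_zero h3 hx0 (by linear_combination h)
  have e2 : b ≠ -2 * b := fun h => mul_ne_zero h3 hy0 (by linear_combination h)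
  have e3 : d ≠ -2 * d := fun h => mul_ne_zero h3 hw0 (by linear_combination h)
  have f1 : b = -2 * a ↔ d = a :=
    ⟨fun h => by linear_combination hz - h, fun h => by linear_combination hz - h⟩
  have f2 : d = -2 * a ↔ b = a :=
    ⟨fun h => by linear_combination hz - h, fun h => by linear_combination hz - h⟩
  have f3 : a = -2 * b ↔ d = b :=
    ⟨fun h => by linear_combination hz - h, fun h => by linear_combination hz - h⟩
  have f4 : d = -2 * b ↔ a = b :=
    ⟨fun h => by linear_combination hz - h, fun h => by linear_combination hz - h⟩
  have f5 : a = -2 * d ↔ b = d :=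
    ⟨fun h => by linear_combination hz - h, fun h => by linear_combination hz - h⟩
  have f6 : b = -2 * d ↔ a = d :=
    ⟨fun h => by linear_combination hz - h, fun h => by linear_combination hz - h⟩
  rw [if_neg e1, if_neg e2, if_neg e3]
  simp only [f1, f2, f3, f4, f5, f6, one_mul, if_true]
  omega

lemma ratioCount_two (h3 : (3 : F) ≠ 0) (h2 : (2 : F) ≠ 0) {A : Finset ι}
    {z : ι → F} (hA : #A = 2) (hz : ∑ x ∈ A, z x = 0) (h0 : ∀ x ∈ A, z x ≠ 0) :
    ratioCount A z (-2) = 0 ∧ ratioCount A z 1 = 2 ∧ ratioCount A z (-1) = 2 := by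
  classical
  obtain ⟨x, y, hxy, rfl⟩ := card_eq_two.1 hA
  have hx0 := h0 x (by simp)
  have hx' : x ∉ ({y} : Finset ι) := by simpa using hxy
  rw [ratioCount_eq_sum_ite, ratioCount_eq_sum_ite, ratioCount_eq_sum_ite]
  simp only [sum_insert hx', sum_singleton] at hz ⊢
  have hy : z y = -z x := by linear_combination hz
  rw [hy]
  generalize z x = a at *
  have e1 : a ≠ -2 * a := fun h => mul_ne_zero h3 hx0 (by linear_combination h)
  have e2 : -a ≠ -2 * a := fun h => hx0 (by linear_combination h)
  have e3 : a ≠ -2 * -a := fun h => hx0 (by linear_combination -h)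
  have e4 : -a ≠ -2 * -a := fun h => mul_ne_zero h3 hx0 (by linear_combination -h)
  have e5 : a ≠ -a := fun h => mul_ne_zero h2 hx0 (by linear_combination h)
  simp only [one_mul, neg_one_mul, neg_neg]
  rw [if_neg e1, if_neg e2, if_neg e3, if_neg e4, if_neg e5, if_neg e5.symm]
  simp

/-- A bound on the number of pairs of ratio `-2` in a zero-sum family of nonzero values. -/
lemma two_mul_ratioCount_le [Fintype F] (h3 : (3 : F) ≠ 0) (h5 : (5 : F) ≠ 0) (h2 : (2 : F) ≠ 0)
    {A : Finset ι} {z : ι → F} (hz : ∑ x ∈ A, z x = 0) (h0 : ∀ x ∈ A, z x ≠ 0) :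
    2 * (ratioCount A z (-2) + #A) + 3 * #A ≤
      #A ^ 2 + ratioCount A z (-1) + 2 * ratioCount A z 1 := by
  have hle := ratioCount_le A z (r := -2) (neg_ne_zero.2 h2)
  obtain h | h | h | h | h | h : #A = 0 ∨ #A = 1 ∨ #A = 2 ∨ #A = 3 ∨ #A = 4 ∨ 5 ≤ #A := by omega
  · rw [h]; omega
  · obtain ⟨x, rfl⟩ := card_eq_one.1 h
    exact absurd (by simpa using hz) (h0 x (by simp))
  · obtain ⟨e1, e2, e3⟩ := ratioCount_two h3 h2 h hz h0
    rw [h, e1, e2, e3]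
    norm_num
  · have := ratioCount_three h3 h hz h0
    rw [h]
    omega
  · have := ratioCount_four h3 h5 h2 h hz h0
    rw [h]
    omega
  -- From five points on, `ratioCount_le` and 5n ≤ n² suffice.
  · nlinarith

end RatioCount

/-! ### A sharper inequality modulo 7. -/

section ModSeven

/-- The variables are the multiplicities of 1, …, 6 in a zero-sum family of at most five nonzero
residues; the products encode u ↦ -2u and u ↦ -u modulo 7. -/
lemma seven_count_bound :
    ∀ a ∈ range 6, ∀ b ∈ range (6 - a), ∀ c ∈ range (6 - a - b), ∀ d ∈ range (6 - a - b - c),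
      ∀ e ∈ range (6 - a - b - c - d), ∀ f ∈ range (6 - a - b - c - d - e),
        (a + 2 * b + 3 * c + 4 * d + 5 * e + 6 * f) % 7 = 0 →
        3 * (a * e + b * c + c * a + d * f + e * d + f * b + (a + b + c + d + e + f)) +
            3 * (a + b + c + d + e + f) ≤ (a + b + c + d + e + f) ^ 2 +
          2 * (a * f + b * e + c * d) +
            3 * (a * a + b * b + c * c + d * d + e * e + f * f) := by
  decide +kernel

lemma sum_zmod_seven {M : Type*} [AddCommMonoid M] (f : ZMod 7 → M) :
    ∑ u, f u = f 0 + f 1 + f 2 + f 3 + f 4 + f 5 + f 6 :=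
  Fin.sum_univ_seven f

lemma zmod_seven_mul_table :
    (-2 : ZMod 7) ≠ 0 ∧
    ((-2 : ZMod 7) * 1 = 5 ∧ (-2 : ZMod 7) * 2 = 3 ∧ (-2 : ZMod 7) * 3 = 1 ∧
      (-2 : ZMod 7) * 4 = 6 ∧ (-2 : ZMod 7) * 5 = 4 ∧ (-2 : ZMod 7) * 6 = 2) ∧
    (-1 : ZMod 7) * 1 = 6 ∧ (-1 : ZMod 7) * 2 = 5 ∧ (-1 : ZMod 7) * 3 = 4 ∧
      (-1 : ZMod 7) * 4 = 3 ∧ (-1 : ZMod 7) * 5 = 2 ∧ (-1 : ZMod 7) * 6 = 1 := by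
  decide

lemma three_mul_ratioCount_le [Fact (Nat.Prime 7)] {ι : Type*} {A : Finset ι} {z : ι → ZMod 7}
    (hz : ∑ x ∈ A, z x = 0) (h0 : ∀ x ∈ A, z x ≠ 0) :
    3 * (ratioCount A z (-2) + #A) + 3 * #A ≤
      #A ^ 2 + ratioCount A z (-1) + 3 * ratioCount A z 1 := by
  obtain ⟨h20, ⟨q1, q2, q3, q4, q5, q6⟩, r1, r2, r3, r4, r5, r6⟩ := zmod_seven_mul_table
  have hle := ratioCount_le A z h20
  by_cases h6 : 6 ≤ #A
  · nlinarith
  have hQ := ratioCount_eq_sum A z (-2)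
  have hC := ratioCount_eq_sum A z (-1)
  have hR := ratioCount_eq_sum A z 1
  have hcard := sum_comp_eq_sum_card_mul A z fun _ => 1
  have hmod : ∑ x ∈ A, z x = ∑ u, (#{y ∈ A | z y = u} : ZMod 7) * u := by
    rw [← sum_fiberwise A z]
    refine sum_congr rfl fun u _ => ?_
    rw [← nsmul_eq_mul, ← sum_const]
    exact sum_congr rfl fun x hx => (mem_filter.1 hx).2
  have hn0 : #{y ∈ A | z y = 0} = 0 := by
    rw [card_eq_zero, filter_eq_empty_iff]
    exact fun {x} hx => h0 x hx
  rw [hz] at hmod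
  simp only [sum_zmod_seven] at hQ hC hR hcard hmod
  rw [q1, q2, q3, q4, q5, q6, hn0] at hQ
  rw [r1, r2, r3, r4, r5, r6, hn0] at hC
  simp only [one_mul, hn0] at hR
  rw [hn0] at hcard hmod
  generalize #{y ∈ A | z y = 1} = a at *
  generalize #{y ∈ A | z y = 2} = b at *
  generalize #{y ∈ A | z y = 3} = c at *
  generalize #{y ∈ A | z y = 4} = d at *
  generalize #{y ∈ A | z y = 5} = e at *
  generalize #{y ∈ A | z y = 6} = f at *
  have hk : #A = a + b + c + d + e + f := by
    zify
    simpa using hcard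
  have hdvd : (a + 2 * b + 3 * c + 4 * d + 5 * e + 6 * f) % 7 = 0 := by
    apply Nat.mod_eq_zero_of_dvd
    rw [← CharP.cast_eq_zero_iff (ZMod 7) 7]
    push_cast
    rw [eq_comm] at hmod
    linear_combination hmod
  have := seven_count_bound a (by rw [mem_range]; omega) b (by rw [mem_range]; omega)
    c (by rw [mem_range]; omega) d (by rw [mem_range]; omega) e (by rw [mem_range]; omega)
    f (by rw [mem_range]; omega) hdvd
  rw [← hk] at this
  zify at this ⊢
  rw [hQ, hC, hR]
  simp only [Nat.cast_zero, zero_mul]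
  linarith

end ModSeven

/-! ### Double counting pairs over all lines. -/

section Plane

variable {P : Type*} {L : Type*} [Fintype P] [Fintype L] [Membership P L] [ProjectivePlane P L]

open scoped Classical in
-- Every point other than `x` lies on one line of the pencil, while `x` lies on all n+1 of them for
-- a plane of order n.
lemma sum_pencil_sum_mem (x : P) (f : P → ℕ) :
    ∑ l ∈ pencil L x, ∑ y with y ∈ l, f y = ∑ y, f y + ProjectivePlane.order P L * f x := by
  have h : ∀ l ∈ pencil L x, ∑ y with y ∈ l, f y = f x + ∑ y ∈ otherPoints x l, f y :=
    fun l hl => by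
      rw [← add_sum_erase _ _ (show x ∈ ({y | y ∈ l} : Finset P) by simpa using hl)]
      congr 2
      ext y
      rw [mem_otherPoints, mem_erase, mem_filter, and_comm]
      simp
  rw [sum_congr rfl h, sum_add_distrib, sum_const, card_pencil, sum_pencil,
    ← add_sum_erase univ f (mem_univ x), smul_eq_mul]
  ring

end Plane

section Support

variable {P : Type*} {L : Type*} [Fintype P] [Membership P L] {F : Type*} [Field F] [DecidableEq F]

open scoped Classical in
/-- The points of `l` at which `c` does not vanish. -/
noncomputable def supportOn (c : P → F) (l : L) : Finset P := {y | y ∈ l ∧ c y ≠ 0}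

@[simp] lemma mem_supportOn {c : P → F} {l : L} {y : P} :
    y ∈ supportOn c l ↔ y ∈ l ∧ c y ≠ 0 := by
  simp [supportOn]

lemma sum_sum_supportOn [Fintype L] (c : P → F) (g : L → P → ℕ) :
    ∑ l, ∑ x ∈ supportOn c l, g l x = ∑ x with c x ≠ 0, ∑ l ∈ pencil L x, g l x := by
  refine sum_comm' fun l x => ?_
  simp

end Support

section Plane

variable {P : Type*} {L : Type*} [Fintype P] [Fintype L] [Membership P L] [ProjectivePlane P L]
  {F : Type*} [Field F] [DecidableEq F]

lemma sum_pencil_card_supportOn (c : P → F) (x : P) (q : P → Prop) [DecidablePred q] :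
    ∑ l ∈ pencil L x, #{y ∈ supportOn c l | q y} =
      #{y | c y ≠ 0 ∧ q y} + ProjectivePlane.order P L * if c x ≠ 0 ∧ q x then 1 else 0 := by
  classical
  rw [card_filter, ← sum_pencil_sum_mem x fun y => if c y ≠ 0 ∧ q y then 1 else 0]
  refine sum_congr rfl fun l _ => ?_
  rw [← card_filter]
  congr 1
  ext y
  simp [and_assoc]

lemma sum_pencil_card_supportOn_eq {c : P → F} {x : P} (hx : c x ≠ 0) {r : F} (hr : r ≠ 0) :
    ∑ l ∈ pencil L x, #{y ∈ supportOn c l | c y = r * c x} =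
      valueCount c (r * c x) + ProjectivePlane.order P L * if r = 1 then 1 else 0 := by
  rw [sum_pencil_card_supportOn, valueCount]
  congr 2
  · ext y
    simp only [mem_filter, mem_univ, true_and, and_iff_right_iff_imp]
    rintro h
    rw [h]
    exact mul_ne_zero hr hx
  · have : c x = r * c x ↔ r = 1 := by
      rw [eq_comm, mul_eq_right₀ hx]
    simp only [hx, this, ne_eq, not_false_eq_true, true_and]

/-- Summing an inequality between the numbers of pairs of given ratios over all lines. -/
lemma sum_valueCount_mul_le [Fintype F] (h3 : (3 : F) ≠ 0) (h2 : (2 : F) ≠ 0) {c : P → F}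
    (hc : IsOrthogonalToLines L c) {ρ : ℕ}
    (H : ∀ A : Finset P, ∑ x ∈ A, c x = 0 → (∀ x ∈ A, c x ≠ 0) →
      ρ * (ratioCount A c (-2) + #A) + 3 * #A ≤
        #A ^ 2 + ratioCount A c (-1) + ρ * ratioCount A c 1) :
    ∑ u with u ≠ 0, (valueCount c u : ℤ) * (ρ * (valueCount c (-2 * u) + 1) +
        2 * ProjectivePlane.order P L + 3) ≤
      ∑ u with u ≠ 0, (valueCount c u : ℤ) *
        (hammingNorm c + valueCount c (-u) + ρ * valueCount c u) := by
  classical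
  set n := ProjectivePlane.order P L with hn
  have hline : ∀ l : L, ∑ x ∈ supportOn c l,
      (ρ * (#{y ∈ supportOn c l | c y = -2 * c x} + 1) + 3) ≤
      ∑ x ∈ supportOn c l, (#(supportOn c l) + #{y ∈ supportOn c l | c y = -1 * c x} +
        ρ * #{y ∈ supportOn c l | c y = 1 * c x}) := fun l => by
    have := H (supportOn c l) (by
      rw [← hc l]
      refine sum_subset (fun x hx => ?_) fun x hx hx' => ?_
      · simpa using (mem_supportOn.1 hx).1
      · by_contra h
        exact hx' (mem_supportOn.2 ⟨(mem_filter.1 hx).2, h⟩))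
      fun x hx => (mem_supportOn.1 hx).2
    simp only [ratioCount] at this
    simp only [sum_add_distrib, ← mul_sum, sum_const, smul_eq_mul, mul_one]
    linarith
  have hsum := sum_le_sum fun l (_ : l ∈ (univ : Finset L)) => hline l
  rw [sum_sum_supportOn, sum_sum_supportOn] at hsum
  have e1 : ∀ x ∈ ({x | c x ≠ 0} : Finset P), ∑ l ∈ pencil L x,
      (ρ * (#{y ∈ supportOn c l | c y = -2 * c x} + 1) + 3) =
        ρ * (valueCount c (-2 * c x) + (n + 1)) + 3 * (n + 1) := fun x hx => by
    have h12 : (-2 : F) ≠ 1 := fun h => h3 (by linear_combination -h)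
    simp only [sum_add_distrib, ← mul_sum, sum_const, smul_eq_mul, mul_one, card_pencil, ← hn]
    rw [sum_pencil_card_supportOn_eq (mem_filter.1 hx).2 (neg_ne_zero.2 h2), if_neg h12]
    ring
  have e2 : ∀ x ∈ ({x | c x ≠ 0} : Finset P), ∑ l ∈ pencil L x,
      (#(supportOn c l) + #{y ∈ supportOn c l | c y = -1 * c x} +
        ρ * #{y ∈ supportOn c l | c y = 1 * c x}) =
        (hammingNorm c + n) + valueCount c (- c x) + ρ * (valueCount c (c x) + n) := fun x hx => by
    have h12 : (-1 : F) ≠ 1 := fun h => h2 (by linear_combination -h)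
    have hx0 := (mem_filter.1 hx).2
    have hall := sum_pencil_card_supportOn (L := L) c x (fun _ => True)
    simp only [filter_true, and_true, if_pos hx0] at hall
    simp only [sum_add_distrib, ← mul_sum]
    rw [sum_pencil_card_supportOn_eq hx0 (neg_ne_zero.2 one_ne_zero), if_neg h12,
      sum_pencil_card_supportOn_eq hx0 one_ne_zero, if_pos rfl, hall, ← hn, hammingNorm]
    simp
  rw [sum_congr rfl e1, sum_congr rfl e2] at hsum
  have hcl : ∀ f : F → ℤ, ∑ x with c x ≠ 0, f (c x) = ∑ u with u ≠ 0, (valueCount c u : ℤ) * f u :=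
    fun f => by
      rw [sum_comp_eq_sum_card_mul, sum_filter]
      refine sum_congr rfl fun u _ => ?_
      split_ifs with hu
      · congr 3
        ext y
        simp only [mem_filter, mem_univ, true_and, and_iff_right_iff_imp]
        rintro rfl
        exact hu
      · rw [not_not] at hu
        have : ({y ∈ ({x | c x ≠ 0} : Finset P) | c y = u}) = ∅ := by
          rw [filter_eq_empty_iff]
          intro y hy hyu
          exact (mem_filter.1 hy).2 (hyu.trans hu)
        rw [this]
        simp
  rw [← hcl fun u => ρ * (valueCount c (-2 * u) + 1) + 2 * n + 3,
    ← hcl fun u => hammingNorm c + valueCount c (-u) + ρ * valueCount c u]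
  zify at hsum
  rw [← sub_nonneg, ← sum_sub_distrib] at hsum ⊢
  convert hsum using 2
  ring

end Plane

/-! ### The second-moment estimate that excludes words with all values. -/

section Deviation

variable {F : Type*} [Field F] [DecidableEq F] [Fintype F]

lemma sum_ne_zero_mul_left {M : Type*} [AddCommMonoid M] (f : F → M) {r : F} (hr : r ≠ 0) :
    ∑ u with u ≠ 0, f (r * u) = ∑ u with u ≠ 0, f u := by
  rw [sum_filter, sum_filter]
  rw [← Equiv.sum_comp (Equiv.mulLeft₀ r hr) fun u => if u ≠ 0 then f u else 0]
  refine sum_congr rfl fun u _ => ?_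
  simp [hr]

lemma sum_ne_zero_neg {M : Type*} [AddCommMonoid M] (f : F → M) :
    ∑ u with u ≠ 0, f (-u) = ∑ u with u ≠ 0, f u := by
  simpa using sum_ne_zero_mul_left f (neg_ne_zero.2 (one_ne_zero (α := F)))

/-- If a nonnegative function on the nonzero elements satisfies `f u + f (-u) ≥ k`, then the sum
of the squares of the numbers `f u + f (-u)` is bounded in terms of their sum. -/
lemma sum_sq_add_neg_le (h2 : (2 : F) ≠ 0) (f : F → ℤ) {k t : ℤ}
    (hf : ∀ u, u ≠ 0 → k ≤ f u + f (-u))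
    (ht : 2 * ∑ u with u ≠ 0, f u = k * #{u : F | u ≠ 0} + t) :
    0 ≤ t ∧ 2 * ∑ u with u ≠ 0, (f u + f (-u)) ^ 2 ≤
      2 * k ^ 2 * #{u : F | u ≠ 0} + 4 * k * t + t ^ 2 := by
  set δ : F → ℤ := fun u => f u + f (-u) - k with hδ
  have hδ0 : ∀ u, u ≠ 0 → 0 ≤ δ u := fun u hu => by
    have := hf u hu
    simp only [hδ]
    linarith
  have hsum : ∑ u with u ≠ 0, δ u = t := by
    simp only [hδ, sum_sub_distrib, sum_add_distrib, sum_ne_zero_neg, sum_const, nsmul_eq_mul]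
    linarith
  have hpair : ∀ u, u ≠ 0 → 2 * δ u ≤ t := fun u hu => by
    have hne : u ≠ -u := fun h => mul_ne_zero h2 hu (by linear_combination h)
    have hneg : δ (-u) = δ u := by
      simp only [hδ, neg_neg]
      ring
    rw [← hsum, two_mul]
    nth_rw 2 [← hneg]
    rw [← sum_pair hne]
    refine sum_le_sum_of_subset_of_nonneg (fun w hw => ?_) fun w hw _ =>
      hδ0 w (by simpa using hw)
    simp only [mem_insert, mem_singleton] at hw
    rcases hw with rfl | rfl <;> simp [hu]
  have hsq : 2 * ∑ u with u ≠ 0, δ u ^ 2 ≤ t ^ 2 := by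
    have : ∑ u with u ≠ 0, 2 * δ u ^ 2 ≤ ∑ u with u ≠ 0, t * δ u := by
      refine sum_le_sum fun u hu => ?_
      have hu0 : u ≠ 0 := by simpa using hu
      nlinarith [hpair u hu0, hδ0 u hu0]
    rw [← mul_sum, ← mul_sum, hsum] at this
    linarith
  constructor
  · rw [← hsum]
    exact sum_nonneg fun u hu => hδ0 u (by simpa using hu)
  · have hexp : ∑ u with u ≠ 0, (f u + f (-u)) ^ 2 =
        k ^ 2 * #{u : F | u ≠ 0} + 2 * k * t + ∑ u with u ≠ 0, δ u ^ 2 := by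
      rw [← hsum, mul_sum, mul_comm (k ^ 2), ← nsmul_eq_mul, ← sum_const, ← sum_add_distrib,
        ← sum_add_distrib]
      refine sum_congr rfl fun u _ => ?_
      simp only [hδ]
      ring
    rw [hexp]
    linarith

end Deviation

section Plane

variable {p : ℕ} [Fact p.Prime] {P : Type*} {L : Type*} [Fintype P] [Fintype L]
  [Membership P L] [ProjectivePlane P L]

lemma natCast_ne_zero_of_lt {t : ℕ} (ht : 0 < t) (htp : t < p) : (t : ZMod p) ≠ 0 := fun h => by
  rw [CharP.cast_eq_zero_iff (ZMod p) p] at h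
  exact absurd (Nat.le_of_dvd ht h) (by omega)

/-- In a word of small weight, not all nonzero values can occur. -/
lemma not_all_values (hp7 : 7 ≤ p) {c : P → ZMod p} (hc : IsOrthogonalToLines L c)
    (hord : ProjectivePlane.order P L = p ^ 2) {k : ℕ}
    (hN : hammingNorm c + 2 * p = 2 * p ^ 2 + 2 + k) (hk : k ≤ 2)
    (hall : ∀ u, u ≠ 0 → 0 < valueCount c u) : False := by
  have hp2 : p ≠ 2 := by omega
  have h2 : (2 : ZMod p) ≠ 0 := by exact_mod_cast natCast_ne_zero_of_lt (p := p) two_pos (by omega)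
  have h3 : (3 : ZMod p) ≠ 0 := by
    exact_mod_cast natCast_ne_zero_of_lt (p := p) (t := 3) (by omega) (by omega)
  have h5 : (5 : ZMod p) ≠ 0 := by
    exact_mod_cast natCast_ne_zero_of_lt (p := p) (t := 5) (by omega) (by omega)
  -- β is the guaranteed multiplicity of each value; f measures the excess over it.
  set β : ℤ := 2 * p + 1 - k with hβ
  set f : ZMod p → ℤ := fun u => valueCount c u - β with hf
  have hm : ∀ u, (valueCount c u : ℤ) = β + f u := fun u => by simp [hf]
  have hlow := fun u (hu : u ≠ 0) =>
    valueCount_lower_bound (L := L) hp2 hc hord hN (by omega) hu (hall u hu)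
  have hf0 : ∀ u, u ≠ 0 → 0 ≤ f u := fun u hu => by
    have := (hlow u hu).1
    simp only [hf, hβ]
    omega
  have hfk : ∀ u, u ≠ 0 → (k : ℤ) ≤ f u + f (-u) := fun u hu => by
    have := (hlow u hu).2.2
    rw [pairCount] at this
    simp only [hf, hβ]
    omega
  have hT : #{u : ZMod p | u ≠ 0} + 1 = p := by
    rw [filter_ne', card_erase_add_one (mem_univ _), card_univ, ZMod.card]
  have hTz : (#{u : ZMod p | u ≠ 0} : ℤ) = p - 1 := by omega
  have hNz : (hammingNorm c : ℤ) = 2 * p ^ 2 - 2 * p + 2 + k := by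
    zify at hN
    linarith
  have hfs : ∑ u with u ≠ 0, f u = 3 + (k - 1) * p := by
    have := sum_valueCount c
    zify at this
    simp only [hm, sum_add_distrib, sum_const, nsmul_eq_mul, hTz, hNz] at this
    rw [hβ] at this
    linarith
  obtain ⟨ht, hG⟩ := sum_sq_add_neg_le h2 f (k := k) (t := 2 * (3 + (k - 1) * p) - k * (p - 1))
    hfk (by rw [hfs, hTz]; ring)
  rw [hTz] at hG
  have hsqs : ∑ u with u ≠ 0, (f u + f (-u)) ^ 2 =
      2 * ∑ u with u ≠ 0, f u ^ 2 + 2 * ∑ u with u ≠ 0, f u * f (-u) := by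
    have : ∀ u, (f u + f (-u)) ^ 2 = f u ^ 2 + f (-u) ^ 2 + 2 * (f u * f (-u)) := fun u => by ring
    simp only [this, sum_add_distrib, ← mul_sum]
    rw [sum_ne_zero_neg fun u => f u ^ 2]
    ring
  have hff : 0 ≤ ∑ u with u ≠ 0, f u * f (-u) := sum_nonneg fun u hu => by
    have hu0 : u ≠ 0 := by simpa using hu
    exact mul_nonneg (hf0 u hu0) (hf0 _ (neg_ne_zero.2 hu0))
  have hff2 : 0 ≤ ∑ u with u ≠ 0, f u * f (-2 * u) := sum_nonneg fun u hu => by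
    have hu0 : u ≠ 0 := by simpa using hu
    exact mul_nonneg (hf0 u hu0) (hf0 _ (mul_ne_zero (neg_ne_zero.2 h2) hu0))
  have key : ∀ ρ : ℕ, (∀ A : Finset P, ∑ x ∈ A, c x = 0 → (∀ x ∈ A, c x ≠ 0) →
      ρ * (ratioCount A c (-2) + #A) + 3 * #A ≤
        #A ^ 2 + ratioCount A c (-1) + ρ * ratioCount A c 1) →
      ρ * (2 * p ^ 2 - 2 * p + 2 + k : ℤ) ≤ ρ * ∑ u with u ≠ 0, f u ^ 2 + β * (3 + (k - 1) * p) +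
        ∑ u with u ≠ 0, f u * f (-u) := fun ρ H => by
    have h := sum_valueCount_mul_le h3 h2 hc H
    rw [← sub_nonneg, ← sum_sub_distrib, hord, hNz] at h
    have hterm : ∀ u, (valueCount c u : ℤ) *
        (2 * p ^ 2 - 2 * p + 2 + k + valueCount c (-u) + ρ * valueCount c u) -
        valueCount c u * (ρ * (valueCount c (-2 * u) + 1) + 2 * (p ^ 2 : ℕ) + 3) =
        ρ * f u ^ 2 + ρ * β * f u - ρ * β * f (-2 * u) - ρ * (f u * f (-2 * u)) + β * f (-u) +
          f u * f (-u) - ρ * (β + f u) := fun u => by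
      rw [hm, hm, hm, hβ]
      push_cast
      ring
    simp only [hterm, sum_sub_distrib, sum_add_distrib, ← mul_sum, sum_ne_zero_neg,
      sum_ne_zero_mul_left f (neg_ne_zero.2 h2), hfs, sum_const, nsmul_eq_mul, hTz] at h
    have h' : (p - 1) * β + (3 + (k - 1) * p) = (2 * p ^ 2 - 2 * p + 2 + k : ℤ) := by
      rw [hβ]
      ring
    rw [h'] at h
    have : 0 ≤ ρ * ∑ u with u ≠ 0, f u * f (-2 * u) := mul_nonneg (by positivity) hff2
    linarith
  have hρ2 := key 2 fun A hz h0 => two_mul_ratioCount_le h3 h5 h2 hz h0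
  push_cast at hρ2
  generalize ∑ u with u ≠ 0, f u ^ 2 = s at *
  generalize ∑ u with u ≠ 0, f u * f (-u) = s' at *
  rw [hsqs] at hG
  -- The slack t in `ht` equals 6-2p, 7-p and 8 in the three cases. It is negative in the first and
  -- forces p = 7 in the second.
  obtain rfl | rfl | rfl : k = 0 ∨ k = 1 ∨ k = 2 := by omega
  · push_cast at ht
    linarith
  · push_cast at ht hG hρ2 hβ
    have h7 : p = 7 := by omega
    subst h7
    rw [hβ] at hρ2
    norm_num at hρ2 hG
    linarith
  · push_cast at ht hG hρ2 hβ
    -- With coefficient ρ = 2 the estimates reduce to 2p² - 13p - 49 ≤ 0, which fails for p ≥ 10 but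
    -- holds at 7; there ρ = 3 is used.
    rcases hp7.eq_or_lt with rfl | hp8
    · have hρ3 := key 3 fun A hz h0 => three_mul_ratioCount_le hz h0
      rw [hβ] at hρ3
      norm_num at hρ3 hG
      linarith
    · have hp10 : 10 ≤ p := by
        by_contra hlt
        have hprime := (Fact.out : p.Prime)
        have : p = 8 ∨ p = 9 := by omega
        rcases this with rfl | rfl <;> norm_num at hprime
      rw [hβ] at hρ2
      nlinarith

/-- A word of small weight takes only two nonzero values, and these are opposite. -/
lemma exists_two_values (hp7 : 7 ≤ p) {c : P → ZMod p} (hc : IsOrthogonalToLines L c)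
    (hord : ProjectivePlane.order P L = p ^ 2) {k : ℕ}
    (hN : hammingNorm c + 2 * p = 2 * p ^ 2 + 2 + k) (hk : k ≤ 2) :
    ∃ u, u ≠ 0 ∧ (∃ x, c x = u) ∧ ∀ y, c y ≠ 0 → c y = u ∨ c y = -u :=
  (two_values_or_all_values hp7 hc hord hN hk).resolve_right
    (not_all_values hp7 hc hord hN hk)

end Plane

/-! ### From secants of constant size to embedded planes. -/

section Blocks

variable {P : Type*} {L : Type*} [Membership P L]

/-- The lines meeting `S` in exactly `q` points. -/
def Block (L : Type*) [Membership P L] (S : Set P) (q : ℕ) : Type _ :=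
  {l : L // {y : P | y ∈ S ∧ y ∈ l}.ncard = q}

instance (S : Set P) (q : ℕ) : Membership S (Block L S q) := ⟨fun l x => (x : P) ∈ l.1⟩

/-- The inclusion of the structure of points of `S` and blocks. -/
def blockEmbedding (S : Set P) (q : ℕ) : IncidenceEmbedding S (Block L S q) P L where
  onPoints := Subtype.val
  onLines := Subtype.val
  onPoints_injective := Subtype.val_injective
  onLines_injective := Subtype.val_injective
  mem_iff _ _ := Iff.rfl

lemma range_blockEmbedding (S : Set P) (q : ℕ) :
    Set.range (blockEmbedding (L := L) S q).onPoints = S := Subtype.range_val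

lemma Block.pointCount_eq {S : Set P} {q : ℕ} (l : Block L S q) : pointCount S l = q :=
  (Nat.card_congr
    (Equiv.subtypeSubtypeEquivSubtypeInter (· ∈ S) fun y => y ∈ l.1)).trans l.2

lemma Block.lineCount_eq_ncard {S : Set P} {q : ℕ} (x : S) :
    lineCount (Block L S q) x =
      {l : L | {y : P | y ∈ S ∧ y ∈ l}.ncard = q ∧ (x : P) ∈ l}.ncard :=
  Nat.card_congr (Equiv.subtypeSubtypeEquivSubtypeInter
    (fun l : L => {y : P | y ∈ S ∧ y ∈ l}.ncard = q) fun l => (x : P) ∈ l)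

instance [Finite L] (S : Set P) (q : ℕ) : Finite (Block L S q) := Subtype.finite

lemma Block.card_eq [Finite P] [Finite L] {S : Set P} {q : ℕ} (hq : 0 < q)
    (h : ∀ x : S, lineCount (Block L S q) x = q) : Nat.card (Block L S q) = Nat.card S := by
  classical
  have := Fintype.ofFinite S
  have := Fintype.ofFinite (Block L S q)
  have hs := sum_lineCount_eq_sum_pointCount S (Block L S q)
  simp only [h, Block.pointCount_eq, sum_const, smul_eq_mul, card_univ] at hs
  rw [Nat.card_eq_fintype_card, Nat.card_eq_fintype_card]
  exact (Nat.eq_of_mul_eq_mul_right hq hs).symm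

variable [ProjectivePlane P L]

lemma isEmbeddedAntipodalPlane_of_blocks [Finite P] [Finite L] {S : Set P} {s : ℕ} (hs : 2 ≤ s)
    (hS : Nat.card S = s ^ 2 + s + 2)
    (h : ∀ x : S, lineCount (Block L S (s + 1)) x = s + 1) :
    IsEmbeddedAntipodalPlane L S s := by
  refine ⟨S, Block L S (s + 1), inferInstance, blockEmbedding S (s + 1), ?_,
    range_blockEmbedding S (s + 1)⟩
  refine { nontrivial := fun l => ?_, line_unique := ?_, two_le := hs, card_points := hS,
           card_lines := ?_, pointCount_eq := Block.pointCount_eq, lineCount_eq := h }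
  · have : 1 < {x : S | x ∈ l}.ncard := by
      have := l.pointCount_eq
      rw [pointCount] at this
      change 1 < Nat.card {x : S // x ∈ l}
      omega
    exact Set.one_lt_ncard_iff_nontrivial.1 this
  · intro x y l m hxy hxl hyl hxm hym
    exact Subtype.ext ((Nondegenerate.eq_or_eq (L := L) hxl hyl hxm hym).resolve_left
      fun h => hxy (Subtype.ext h))
  · rw [Block.card_eq (by omega) h, hS]

lemma isEmbeddedProjectivePlane_of_blocks [Finite P] [Finite L] {S : Set P} {s : ℕ} (hs : 2 ≤ s)
    (hS : Nat.card S = s ^ 2 + s + 1)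
    (h : ∀ x : S, lineCount (Block L S (s + 1)) x = s + 1)
    (hjoin : ∀ x ∈ S, ∀ y ∈ S, x ≠ y → ∀ l : L, x ∈ l → y ∈ l →
      {y : P | y ∈ S ∧ y ∈ l}.ncard = s + 1) :
    IsEmbeddedProjectivePlane L S s := by
  classical
  have := Fintype.ofFinite S
  have := Fintype.ofFinite (Block L S (s + 1))
  have hcard := Block.card_eq (by omega) h
  have hpts : ∀ l : Block L S (s + 1), #{x : S | x ∈ l} = s + 1 := fun l => by
    refine Eq.trans ?_ l.pointCount_eq
    rw [pointCount, Nat.card_eq_fintype_card, Fintype.card_subtype]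
  have hlns : ∀ x : S, #{l : Block L S (s + 1) | x ∈ l} = s + 1 := fun x => by
    refine Eq.trans ?_ (h x)
    rw [lineCount, Nat.card_eq_fintype_card, Fintype.card_subtype]
  have hQ : #(univ : Finset S) = s ^ 2 + s + 1 := by
    rw [card_univ, ← Nat.card_eq_fintype_card, hS]
  have hM : #(univ : Finset (Block L S (s + 1))) = s ^ 2 + s + 1 := by
    rw [card_univ, ← Nat.card_eq_fintype_card, hcard, hS]
  have huniq : ∀ {x y : S} {l m : Block L S (s + 1)}, x ∈ l → y ∈ l → x ∈ m → y ∈ m →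
      x = y ∨ l = m := fun hxl hyl hxm hym =>
    (Nondegenerate.eq_or_eq (L := L) hxl hyl hxm hym).imp Subtype.ext Subtype.ext
  -- 2s+1 is the size of the union of two blocks through a common point, below s²+s+1 because s ≥ 2.
  have hpt : ∀ T : Finset S, #T ≤ 2 * s + 1 → ∃ x, x ∉ T := fun T hT => by
    by_contra! hall
    have := card_le_card (fun x _ => hall x : univ ⊆ T)
    nlinarith
  have hln : ∀ T : Finset (Block L S (s + 1)), #T ≤ 2 * s + 1 → ∃ l, l ∉ T := fun T hT => by
    by_contra! hall
    have := card_le_card (fun x _ => hall x : univ ⊆ T)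
    nlinarith
  let hLines : HasLines S (Block L S (s + 1)) :=
    { exists_point := fun l => by
        obtain ⟨x, hx⟩ := hpt {x : S | x ∈ l} (by rw [hpts]; omega)
        exact ⟨x, by simpa using hx⟩
      exists_line := fun x => by
        obtain ⟨l, hl⟩ := hln {l : Block L S (s + 1) | x ∈ l} (by rw [hlns]; omega)
        exact ⟨l, by simpa using hl⟩
      eq_or_eq := huniq
      mkLine := fun {x y} hxy =>
        have hne : (x : P) ≠ y := fun h => hxy (Subtype.ext h)
        ⟨HasLines.mkLine hne, hjoin x x.2 y y.2 hne _ (HasLines.mkLine_ax hne).1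
          (HasLines.mkLine_ax hne).2⟩
      mkLine_ax := fun {x y} hxy =>
        have hne : (x : P) ≠ y := fun h => hxy (Subtype.ext h)
        ⟨(HasLines.mkLine_ax (L := L) hne).1, (HasLines.mkLine_ax (L := L) hne).2⟩ }
  -- Equality of the numbers of points and blocks upgrades the joining axiom to the intersection
  -- axiom.
  let hPoints : HasPoints S (Block L S (s + 1)) := HasLines.hasPoints (by
    rw [← Nat.card_eq_fintype_card, ← Nat.card_eq_fintype_card, hcard])
  have hconfig : ∃ (p₁ p₂ p₃ : S) (l₁ l₂ l₃ : Block L S (s + 1)),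
      p₁ ∉ l₂ ∧ p₁ ∉ l₃ ∧ p₂ ∉ l₁ ∧ p₂ ∈ l₂ ∧ p₂ ∈ l₃ ∧ p₃ ∉ l₁ ∧ p₃ ∈ l₂ ∧ p₃ ∉ l₃ := by
    obtain ⟨p₂, -⟩ := hpt ∅ (by simp)
    obtain ⟨l₂, hl₂, l₃, hl₃, hne⟩ := one_lt_card.1
      (show 1 < #{l : Block L S (s + 1) | p₂ ∈ l} by rw [hlns]; omega)
    rw [mem_filter] at hl₂ hl₃
    obtain ⟨p₃, hp₃, hp₃'⟩ := exists_mem_ne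
      (show 1 < #{x : S | x ∈ l₂} by rw [hpts]; omega) p₂
    rw [mem_filter] at hp₃
    have hp₃l : p₃ ∉ l₃ := fun hmem =>
      (huniq hp₃.2 hl₂.2 hmem hl₃.2).elim hp₃' hne
    obtain ⟨p₁, hp₁⟩ := hpt (({x : S | x ∈ l₂} : Finset S) ∪ ({x : S | x ∈ l₃} : Finset S).erase p₂) (by
      refine (card_union_le _ _).trans ?_
      rw [card_erase_of_mem (by simpa using hl₃.2), hpts, hpts]
      omega)
    obtain ⟨l₁, hl₁⟩ := hln (({l | p₂ ∈ l} : Finset (Block L S (s + 1))) ∪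
        ({l | p₃ ∈ l} : Finset (Block L S (s + 1))).erase l₂) (by
      refine (card_union_le _ _).trans ?_
      rw [card_erase_of_mem (by simpa using hp₃.2), hlns, hlns]
      omega)
    simp only [mem_union, mem_filter, mem_univ, true_and, mem_erase, not_or, not_and] at hp₁ hl₁
    refine ⟨p₁, p₂, p₃, l₁, l₂, l₃, hp₁.1, hp₁.2 ?_, hl₁.1, hl₂.2, hl₃.2, hl₁.2 ?_, hp₃.2, hp₃l⟩
    · rintro rfl
      exact hp₁.1 hl₂.2
    · rintro rfl
      exact hl₁.1 hl₂.2
  let hPlane : ProjectivePlane S (Block L S (s + 1)) :=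
    { hPoints, hLines with exists_config := hconfig }
  refine ⟨S, Block L S (s + 1), inferInstance, hPlane, blockEmbedding S (s + 1), ?_,
    range_blockEmbedding S (s + 1)⟩
  obtain ⟨x, -⟩ := hpt ∅ (by simp)
  have := ProjectivePlane.lineCount_eq (L := Block L S (s + 1)) x
  rw [h x] at this
  omega

end Blocks

/-! ### Words with the two values 1 and -1. -/

open scoped Classical in
/-- The number of points of `l` at which `c` takes the value `v`. -/
noncomputable def valueCountOn {P L F : Type*} [Fintype P] [Membership P L] (c : P → F) (l : L)
    (v : F) : ℕ := #{y | y ∈ l ∧ c y = v}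

lemma ncard_inter_line {P L F : Type*} [Fintype P] [Membership P L] (c : P → F) (v : F)
    (l : L) :
    {y : P | y ∈ {x | c x = v} ∧ y ∈ l}.ncard = valueCountOn c l v := by
  classical
  rw [Set.ncard_eq_toFinset_card', valueCountOn]
  congr 1
  ext y
  simp [and_comm]

section Plane

variable {p : ℕ} [Fact p.Prime] {P : Type*} {L : Type*} [Fintype P] [Membership P L]

lemma sum_val_eq_of_two_values (hp2 : p ≠ 2) {c : P → ZMod p}
    (hV : ∀ y, c y ≠ 0 → c y = 1 ∨ c y = -1) (A : Finset P) :
    ∑ y ∈ A, (c y).val = #{y ∈ A | c y = 1} + (p - 1) * #{y ∈ A | c y = -1} := by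
  have hp := (Fact.out : p.Prime).two_le
  have : Fact (1 < p) := ⟨by omega⟩
  have : Fact (2 < p) := ⟨by omega⟩
  rw [card_filter, card_filter, mul_sum, ← sum_add_distrib]
  refine sum_congr rfl fun y _ => ?_
  have hv := val_neg_natCast (p := p) (i := 1) one_pos (by omega)
  rw [Nat.cast_one] at hv
  by_cases h : c y = 0
  · rw [h, if_neg zero_ne_one, if_neg (neg_ne_zero.2 one_ne_zero).symm]
    simp
  · rcases hV y h with h | h
    · rw [h, ZMod.val_one, if_pos rfl, if_neg ZMod.neg_one_ne_one.symm]
      simp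
    · rw [h, hv, if_pos rfl, if_neg ZMod.neg_one_ne_one]
      simp

lemma sum_val_line_eq_of_two_values (hp2 : p ≠ 2) {c : P → ZMod p}
    (hV : ∀ y, c y ≠ 0 → c y = 1 ∨ c y = -1) (l : L) {T : Finset P} (hT : ∀ y, y ∈ T ↔ y ∈ l) :
    ∑ y ∈ T, (c y).val = valueCountOn c l 1 + (p - 1) * valueCountOn c l (-1) := by
  classical
  rw [sum_val_eq_of_two_values hp2 hV]
  unfold valueCountOn
  congr 2
  · ext y
    simp [hT]
  · congr 1
    ext y
    simp [hT]

lemma valueCountOn_neg (c : P → ZMod p) (l : L) (v : ZMod p) :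
    valueCountOn (-c) l v = valueCountOn c l (-v) := by
  unfold valueCountOn
  congr 1
  ext y
  simp [neg_eq_iff_eq_neg]

variable [Fintype L] [ProjectivePlane P L]

lemma sum_pencil_valueCountOn {F : Type*} [DecidableEq F] (c : P → F) (x : P) (v : F) :
    ∑ l ∈ pencil L x, valueCountOn c l v =
      valueCount c v + ProjectivePlane.order P L * if c x = v then 1 else 0 := by
  classical
  rw [valueCount, card_filter, ← sum_pencil_sum_mem x fun y => if c y = v then 1 else 0]
  refine sum_congr rfl fun l _ => ?_
  rw [← card_filter, filter_filter]
  unfold valueCountOn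
  congr

/-- The lift of -1 is p-1, so the lifted line sum depends only on the two counts; summing over the
pencil identifies the total excess with κ. -/
lemma exists_line_excess {c : P → ZMod p} (hp2 : p ≠ 2) (hc : IsOrthogonalToLines L c)
    (hV : ∀ y, c y ≠ 0 → c y = 1 ∨ c y = -1) {R κ : ℕ} (hR : ProjectivePlane.order P L + 1 = R)
    (hκ : liftSum c + R = p * (κ + R) + 1) {x : P} (hx : c x = 1) :
    ∃ e : L → ℕ, (∀ l ∈ pencil L x,
      valueCountOn c l 1 + (p - 1) * valueCountOn c l (-1) = p * (e l + 1)) ∧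
      ∑ l ∈ pencil L x, e l = κ := by
  classical
  have hp := (Fact.out : p.Prime).pos
  have : Fact (1 < p) := ⟨(Fact.out : p.Prime).one_lt⟩
  have hsum : ∀ l : L, valueCountOn c l 1 + (p - 1) * valueCountOn c l (-1) =
      ∑ y with y ∈ l, (c y).val := fun l =>
    (sum_val_line_eq_of_two_values hp2 hV l fun y => by simp).symm
  have he : ∀ l : L, ∃ e, l ∈ pencil L x →
      valueCountOn c l 1 + (p - 1) * valueCountOn c l (-1) = p * (e + 1) := fun l => by
    by_cases hl : l ∈ pencil L x
    · have hd : p ∣ ∑ y with y ∈ l, (c y).val := by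
        rw [← CharP.cast_eq_zero_iff (ZMod p) p]
        push_cast
        simp only [ZMod.natCast_val, ZMod.cast_id', id]
        rw [← hc l]
      obtain ⟨q, hq⟩ := hd
      rcases q with _ | e
      · have h1 : (c x).val ≤ ∑ y with y ∈ l, (c y).val :=
          single_le_sum (f := fun y => (c y).val) (fun _ _ => Nat.zero_le _)
            (by simpa using hl)
        rw [hx, ZMod.val_one, hq] at h1
        simp at h1
      · exact ⟨e, fun _ => by rw [hsum, hq]⟩
    · exact ⟨0, fun h => absurd h hl⟩
  choose e he using he
  refine ⟨e, he, ?_⟩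
  have h1 := sum_congr (s₁ := pencil L x) rfl he
  simp only [hsum] at h1
  rw [sum_pencil_sum_mem, ← mul_sum, sum_add_distrib, sum_const, card_pencil, hx, ZMod.val_one,
    hR, smul_eq_mul, mul_one, mul_one] at h1
  have h2 : p * (∑ l ∈ pencil L x, e l + R) = p * (κ + R) := by
    rw [← h1]
    rw [liftSum] at hκ
    omega
  have := Nat.eq_of_mul_eq_mul_left hp h2
  omega

/-- The possible numbers of points of value `1` and `-1` on a line with small excess. -/
lemma line_types (hp7 : 7 ≤ p) {a b e : ℕ} (he : e ≤ 1) (ha : 1 ≤ a)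
    (h : a + (p - 1) * b = p * (e + 1)) (h' : 1 ≤ b → ∃ e' ≤ 1, b + (p - 1) * a = p * (e' + 1)) :
    (a = p ∧ b = 0 ∧ e = 0) ∨ (a = 1 ∧ b = 1 ∧ e = 0) ∨ (a = 2 ∧ b = 2 ∧ e = 1) ∨
      (a = 2 * p ∧ b = 0 ∧ e = 1) := by
  obtain ⟨q, rfl⟩ : ∃ q, p = q + 1 := ⟨p - 1, by omega⟩
  rw [Nat.add_sub_cancel] at *
  have hb : b < 3 := by
    by_contra! hb
    have : q * 3 ≤ q * b := Nat.mul_le_mul_left q hb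
    have : (q + 1) * (e + 1) ≤ (q + 1) * 2 := Nat.mul_le_mul_left _ (by omega)
    omega
  have he' : e = 0 ∨ e = 1 := by omega
  interval_cases b
  · rcases he' with rfl | rfl <;> omega
  · obtain ⟨e', he1, h1⟩ := h' le_rfl
    rcases he' with rfl | rfl
    · omega
    · have h2 : a = q + 2 := by omega
      have : (q + 1) * (e' + 1) ≤ (q + 1) * 2 := Nat.mul_le_mul_left _ (by omega)
      rw [h2] at h1
      nlinarith
  · rcases he' with rfl | rfl <;> omega

/-- Every line meeting the points of value `1` meets them in `p`, `1` or `2` points, where the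
last case occurs with two points of value `-1`. -/
lemma exists_line_excess_of_two_values (hp7 : 7 ≤ p) {c : P → ZMod p}
    (hc : IsOrthogonalToLines L c) (hord : ProjectivePlane.order P L = p ^ 2)
    (hV : ∀ y, c y ≠ 0 → c y = 1 ∨ c y = -1) {κ : ℕ} (hκ1 : κ ≤ 1)
    (hκ : liftSum c + (p ^ 2 + 1) = p * (κ + (p ^ 2 + 1)) + 1)
    (hκ' : liftSum (-c) + (p ^ 2 + 1) = p * (κ + (p ^ 2 + 1)) + 1)
    (h1 : valueCount c 1 + p = p ^ 2 + 1 + κ) (h1' : valueCount c (-1) + p = p ^ 2 + 1 + κ)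
    {x : P} (hx : c x = 1) :
    ∃ e : L → ℕ, (∀ l ∈ pencil L x,
      (valueCountOn c l 1 = p ∧ valueCountOn c l (-1) = 0 ∧ e l = 0) ∨
      (valueCountOn c l 1 = 1 ∧ valueCountOn c l (-1) = 1 ∧ e l = 0) ∨
      (valueCountOn c l 1 = 2 ∧ valueCountOn c l (-1) = 2 ∧ e l = 1)) ∧
      ∑ l ∈ pencil L x, e l = κ := by
  classical
  have hp2 : p ≠ 2 := by omega
  have : Fact (2 < p) := ⟨by omega⟩
  have hR : ProjectivePlane.order P L + 1 = p ^ 2 + 1 := by rw [hord]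
  have hc' : IsOrthogonalToLines L (-c) := by
    have := hc.smul (-1)
    rwa [neg_one_smul] at this
  have hV' : ∀ y, (-c) y ≠ 0 → (-c) y = 1 ∨ (-c) y = -1 := fun y hy => by
    have := hV y (by simpa using hy)
    rw [Pi.neg_apply, neg_eq_iff_eq_neg, neg_inj]
    exact this.symm
  have htypes : ∀ x, c x = 1 → ∃ e : L → ℕ, (∀ l ∈ pencil L x,
      (valueCountOn c l 1 = p ∧ valueCountOn c l (-1) = 0 ∧ e l = 0) ∨
      (valueCountOn c l 1 = 1 ∧ valueCountOn c l (-1) = 1 ∧ e l = 0) ∨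
      (valueCountOn c l 1 = 2 ∧ valueCountOn c l (-1) = 2 ∧ e l = 1) ∨
      (valueCountOn c l 1 = 2 * p ∧ valueCountOn c l (-1) = 0 ∧ e l = 1)) ∧
      ∑ l ∈ pencil L x, e l = κ := fun x hx => by
    obtain ⟨e, he, hes⟩ := exists_line_excess hp2 hc hV hR hκ hx
    refine ⟨e, fun l hl => ?_, hes⟩
    have hle : e l ≤ 1 := (single_le_sum (fun _ _ => Nat.zero_le _) hl).trans (hes.le.trans hκ1)
    refine line_types hp7 hle (card_pos.2 ⟨x, ?_⟩) (he l hl) fun hb => ?_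
    · simpa [hx] using hl
    · obtain ⟨x', hx'⟩ := card_pos.1 hb
      simp only [mem_filter, mem_univ, true_and] at hx'
      obtain ⟨e', he', hes'⟩ := exists_line_excess hp2 hc' hV' hR hκ'
        (show (-c) x' = 1 by rw [Pi.neg_apply, hx'.2, neg_neg])
      have hl' := mem_pencil.2 hx'.1
      refine ⟨e' l, (single_le_sum (fun _ _ => Nat.zero_le _) hl').trans (hes'.le.trans hκ1), ?_⟩
      have := he' l hl'
      rwa [valueCountOn_neg, valueCountOn_neg, neg_neg] at this
  -- no line contains `2 * p` points of value `1`
  have hno : ∀ l : L, valueCountOn c l 1 ≠ 2 * p := fun m hm => by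
    obtain ⟨y, hy, hym⟩ := exists_mem_notMem_of_card_lt_card
      (show valueCountOn c m 1 < #{y | c y = 1} by
        change _ < valueCount c 1
        nlinarith)
    rw [mem_filter] at hy
    have hym' : y ∉ m := fun h => hym (by simpa [hy.2] using h)
    obtain ⟨e, he, hes⟩ := htypes y hy.2
    have hb := sum_pencil_valueCountOn (L := L) c y (-1)
    rw [hy.2, if_neg ZMod.neg_one_ne_one.symm, mul_zero, add_zero] at hb
    have hm2 := sum_pencil_sum_mem (L := L) y fun z => if z ∈ m ∧ c z = 1 then 1 else 0
    rw [if_neg fun h => hym' h.1, mul_zero, add_zero, ← card_filter] at hm2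
    have hm3 : #{z | z ∈ m ∧ c z = 1} = 2 * p := by
      rw [← hm, valueCountOn]
      congr
    rw [hm3] at hm2
    -- Count, from a point y of value 1 off m, the 2p points of m together with all points of value
    -- -1. Each line through y carries at most 1+2e of them, so the total gives p ≤ κ, a
    -- contradiction.
    have hle : ∑ l ∈ pencil L y, (∑ z with z ∈ l, (if z ∈ m ∧ c z = 1 then 1 else 0) +
        valueCountOn c l (-1)) ≤ ∑ l ∈ pencil L y, (1 + 2 * e l) := by
      refine sum_le_sum fun l hl => ?_
      rw [← card_filter, filter_filter]
      have hlm : l ≠ m := fun h => hym' (h ▸ mem_pencil.1 hl)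
      have hone : #{z | z ∈ l ∧ z ∈ m ∧ c z = 1} ≤ 1 := by
        refine card_le_one.2 fun z hz w hw => ?_
        simp only [mem_filter, mem_univ, true_and] at hz hw
        exact (Nondegenerate.eq_or_eq hz.1 hw.1 hz.2.1 hw.2.1).resolve_right hlm
      have hzero : valueCountOn c l 1 = 1 → #{z | z ∈ l ∧ z ∈ m ∧ c z = 1} = 0 := fun h => by
        rw [card_eq_zero, filter_eq_empty_iff]
        rintro z - ⟨hzl, hzm, hz⟩
        have hzy := card_le_one.1 h.le z (by simp [hzl, hz]) y
          (by simpa [hy.2] using hl)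
        exact hym' (hzy ▸ hzm)
      rcases he l hl with h | h | h | h
      · omega
      · have := hzero h.1
        omega
      · omega
      · omega
    rw [sum_add_distrib, hm2, hb, sum_add_distrib, ← mul_sum, hes, sum_const, card_pencil, hR,
      smul_eq_mul, mul_one] at hle
    omega
  obtain ⟨e, he, hes⟩ := htypes x hx
  refine ⟨e, fun l hl => ?_, hes⟩
  rcases he l hl with h | h | h | h
  · exact Or.inl h
  · exact Or.inr (Or.inl h)
  · exact Or.inr (Or.inr h)
  · exact absurd h.1 (hno l)

/-- The points of value `1` form an embedded projective or antipodal plane. -/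
lemma isEmbedded_of_two_values (hp7 : 7 ≤ p) {c : P → ZMod p}
    (hc : IsOrthogonalToLines L c) (hord : ProjectivePlane.order P L = p ^ 2)
    (hV : ∀ y, c y ≠ 0 → c y = 1 ∨ c y = -1) {κ : ℕ} (hκ1 : κ ≤ 1)
    (hκ : liftSum c + (p ^ 2 + 1) = p * (κ + (p ^ 2 + 1)) + 1)
    (hκ' : liftSum (-c) + (p ^ 2 + 1) = p * (κ + (p ^ 2 + 1)) + 1)
    (h1 : valueCount c 1 + p = p ^ 2 + 1 + κ) (h1' : valueCount c (-1) + p = p ^ 2 + 1 + κ) :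
    (κ = 0 → IsEmbeddedProjectivePlane L {x | c x = 1} (p - 1)) ∧
      (κ = 1 → IsEmbeddedAntipodalPlane L {x | c x = 1} (p - 1)) := by
  classical
  have : Fact (2 < p) := ⟨by omega⟩
  have hcard : Nat.card {x | c x = 1} = valueCount c 1 := by
    rw [Nat.card_eq_fintype_card, valueCount]
    exact Fintype.card_subtype _
  obtain ⟨s, rfl⟩ : ∃ s, p = s + 1 := ⟨p - 1, by omega⟩
  rw [Nat.add_sub_cancel]
  have hex := fun {x : P} (hx : c x = 1) =>
    exists_line_excess_of_two_values hp7 hc hord hV hκ1 hκ hκ' h1 h1' hx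
  have hblocks : ∀ x : {x | c x = 1}, lineCount (Block L {x | c x = 1} (s + 1)) x = s + 1 := by
    rintro ⟨x, hx⟩
    rw [Block.lineCount_eq_ncard]
    simp only [ncard_inter_line]
    have hset : {l : L | valueCountOn c l 1 = s + 1 ∧ x ∈ l}.ncard =
        ∑ l ∈ pencil L x, if valueCountOn c l 1 = s + 1 then 1 else 0 := by
      rw [Set.ncard_eq_toFinset_card', ← card_filter]
      congr 1
      ext l
      simp [and_comm]
    rw [hset]
    obtain ⟨e, he, hes⟩ := hex hx
    have hb := sum_pencil_valueCountOn (L := L) c x (-1)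
    rw [show c x = 1 from hx, if_neg ZMod.neg_one_ne_one.symm, mul_zero, add_zero] at hb
    -- In all three line types the summand is 1+e. Subtracting the p²-p+1+κ points of value -1 from
    -- the total p²+1+κ leaves exactly p blocks.
    have hsum : ∑ l ∈ pencil L x, ((if valueCountOn c l 1 = s + 1 then 1 else 0) +
        valueCountOn c l (-1)) = ∑ l ∈ pencil L x, (1 + e l) := by
      refine sum_congr rfl fun l hl => ?_
      rcases he l hl with h | h | h
      · rw [if_pos h.1]
        omega
      · rw [if_neg (by omega)]
        omega
      · rw [if_neg (by omega)]
        omega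
    rw [sum_add_distrib, sum_add_distrib, hb, hes, sum_const, card_pencil, hord, smul_eq_mul,
      mul_one] at hsum
    omega
  constructor
  · rintro rfl
    refine isEmbeddedProjectivePlane_of_blocks (by omega) ?_ hblocks ?_
    · rw [hcard]
      nlinarith
    · intro x hx y hy hxy l hxl hyl
      rw [ncard_inter_line]
      obtain ⟨e, he, hes⟩ := hex hx
      have hl : l ∈ pencil L x := mem_pencil.2 hxl
      have he0 : e l = 0 := Nat.le_zero.1
        ((single_le_sum (fun _ _ => Nat.zero_le _) hl).trans hes.le)
      have h2 : 1 < valueCountOn c l 1 := by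
        refine one_lt_card.2 ⟨x, ?_, y, ?_, hxy⟩
        · simpa using ⟨hxl, hx⟩
        · simpa using ⟨hyl, hy⟩
      rcases he l hl with h | h | h
      · exact h.1
      · omega
      · omega
  · rintro rfl
    refine isEmbeddedAntipodalPlane_of_blocks (by omega) ?_ hblocks
    rw [hcard]
    nlinarith

/-- The shape of a word of small weight. -/
lemma exists_eq_smul_sub (hp7 : 7 ≤ p) {c : P → ZMod p} (hc : IsOrthogonalToLines L c)
    (hord : ProjectivePlane.order P L = p ^ 2) {k : ℕ}
    (hN : hammingNorm c + 2 * p = 2 * p ^ 2 + 2 + k) (hk : k ≤ 2) :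
    k ≠ 1 ∧ ∃ (a : ZMod p) (S₁ S₂ : Set P), a ≠ 0 ∧ Disjoint S₁ S₂ ∧
      (k = 0 → IsEmbeddedProjectivePlane L S₁ (p - 1) ∧ IsEmbeddedProjectivePlane L S₂ (p - 1)) ∧
      (k = 2 → IsEmbeddedAntipodalPlane L S₁ (p - 1) ∧ IsEmbeddedAntipodalPlane L S₂ (p - 1)) ∧
      c = a • (incidenceVector (ZMod p) S₁ - incidenceVector (ZMod p) S₂) := by
  classical
  have hp2 : p ≠ 2 := by omega
  have : Fact (2 < p) := ⟨by omega⟩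
  obtain ⟨u, hu, ⟨x, hx⟩, hV⟩ := exists_two_values hp7 hc hord hN hk
  set w := u⁻¹ • c with hw
  have hwc := hc.smul u⁻¹
  rw [← hw] at hwc
  have hw1 : ∀ y, w y = 1 ↔ c y = u := fun y => by
    rw [hw, Pi.smul_apply, smul_eq_mul, inv_mul_eq_iff_eq_mul₀ hu, mul_one]
  have hw2 : ∀ y, w y = -1 ↔ c y = -u := fun y => by
    rw [hw, Pi.smul_apply, smul_eq_mul, inv_mul_eq_iff_eq_mul₀ hu, mul_neg, mul_one]
  have hw0 : ∀ y, w y = 0 ↔ c y = 0 := fun y => by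
    rw [hw, Pi.smul_apply, smul_eq_mul, inv_mul_eq_iff_eq_mul₀ hu, mul_zero]
  have hwV : ∀ y, w y ≠ 0 → w y = 1 ∨ w y = -1 := fun y hy => by
    rw [hw1, hw2]
    exact hV y fun h => hy ((hw0 y).2 h)
  have hwV' : ∀ y, (-w) y ≠ 0 → (-w) y = 1 ∨ (-w) y = -1 := fun y hy => by
    have := hwV y (by simpa using hy)
    rw [Pi.neg_apply, neg_eq_iff_eq_neg, neg_inj]
    exact this.symm
  have hwN : hammingNorm w = hammingNorm c := hammingNorm_smul_of_ne_zero c (inv_ne_zero hu)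
  obtain ⟨κ, κ', hκ, hκ', hκN, -⟩ := exists_antipodal_bounds (L := L) hp2 hwc
    ⟨x, (hw1 x).2 hx⟩ hord (by rw [hwN]; omega)
  have hkk : κ + κ' = k := by omega
  have hH : liftSum w = valueCount w 1 + (p - 1) * valueCount w (-1) :=
    sum_val_eq_of_two_values hp2 hwV univ
  have hH' : liftSum (-w) = valueCount w (-1) + (p - 1) * valueCount w 1 := by
    have := sum_val_eq_of_two_values hp2 hwV' univ
    change liftSum (-w) = valueCount (-w) 1 + (p - 1) * valueCount (-w) (-1) at this
    rw [this, valueCount_neg, valueCount_neg, neg_neg]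
  have hHH := liftSum_add_liftSum_neg w
  obtain ⟨heq, hm, hm'⟩ : κ = κ' ∧ valueCount w 1 + p = p ^ 2 + 1 + κ ∧
      valueCount w (-1) + p = p ^ 2 + 1 + κ := by
    rw [hH] at hκ hHH
    rw [hH'] at hκ' hHH
    have hp1 : ((p - 1 : ℕ) : ℤ) = p - 1 := by omega
    zify at hκ hκ' hHH
    rw [hp1] at hκ hκ' hHH
    generalize ha : (valueCount w 1 : ℤ) = a at *
    generalize hb' : (valueCount w (-1) : ℤ) = b at *
    have hdiff : (p - 2 : ℤ) * (b - a) = p * (κ - κ') := by linarith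
    -- Since |2(κ-κ')| ≤ 4 < p-2, divisibility forces κ = κ'; this is what rules out k = 1.
    have hdvd : (p - 2 : ℤ) ∣ 2 * (κ - κ') :=
      ⟨b - a - (κ - κ'), by linear_combination -hdiff⟩
    have hz : (2 * (κ - κ') : ℤ) = 0 := by
      refine Int.eq_zero_of_abs_lt_dvd hdvd ?_
      rw [abs_lt]
      constructor <;> omega
    have hκκ : κ = κ' := by omega
    subst hκκ
    have hab : b = a := by
      rw [sub_self, mul_zero] at hdiff
      rcases mul_eq_zero.1 hdiff with h | h <;> omega
    subst hab
    have hb : b + p = p ^ 2 + 1 + κ := by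
      have hp0 : (p : ℤ) ≠ 0 := by omega
      refine mul_left_cancel₀ hp0 ?_
      linarith
    refine ⟨rfl, ?_, ?_⟩ <;> · zify; linarith
  subst heq
  have hnc : IsOrthogonalToLines L (-w) := by
    have := hwc.smul (-1)
    rwa [neg_one_smul] at this
  obtain ⟨e1, e2⟩ := isEmbedded_of_two_values hp7 hwc hord hwV (by omega) hκ hκ' hm hm'
  obtain ⟨e1', e2'⟩ := isEmbedded_of_two_values hp7 hnc hord hwV' (κ := κ) (by omega) hκ'
    (by rwa [neg_neg]) (by rwa [valueCount_neg]) (by rwa [valueCount_neg, neg_neg])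
  refine ⟨by omega, u, {y | w y = 1}, {y | (-w) y = 1}, hu, ?_,
    fun h => ⟨e1 (by omega), e1' (by omega)⟩, fun h => ⟨e2 (by omega), e2' (by omega)⟩, ?_⟩
  · rw [Set.disjoint_left]
    intro y hy hy'
    simp only [Set.mem_ofPred_eq, Pi.neg_apply] at hy hy'
    rw [hy] at hy'
    exact ZMod.neg_one_ne_one hy'
  · ext y
    have hcw : c y = u * w y := by
      rw [hw, Pi.smul_apply, smul_eq_mul, mul_inv_cancel_left₀ hu]
    have h11 : (1 : ZMod p) ≠ -1 := ZMod.neg_one_ne_one.symm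
    rw [hcw]
    simp only [incidenceVector, Pi.smul_apply, Pi.sub_apply, Set.indicator_apply, Set.mem_ofPred_eq,
      Pi.neg_apply, Pi.one_apply, smul_eq_mul]
    congr 1
    by_cases h : w y = 0
    · simp [h]
    · rcases hwV y h with h | h
      · simp [h, h11.symm]
      · simp [h, h11.symm]

end Plane

/-! ### Nonzero dual words. -/

section Existence

variable {P : Type*} {L : Type*} [Fintype P] [Membership P L]

/-- The difference of two sets that every line meets in `1` point modulo `p`. -/
lemma incidenceVector_sub_mem_dualCode {p : ℕ} {S T : Set P}
    (hS : ∀ l : L, ({y : P | y ∈ S ∧ y ∈ l}.ncard : ZMod p) = 1)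
    (hT : ∀ l : L, ({y : P | y ∈ T ∧ y ∈ l}.ncard : ZMod p) = 1) :
    incidenceVector (ZMod p) S - incidenceVector (ZMod p) T ∈ dualCode (code P L (ZMod p)) := by
  classical
  rw [mem_dualCode_code_iff]
  have key : ∀ (U : Set P) (l : L), ∑ y with y ∈ l, incidenceVector (ZMod p) U y =
      ({y : P | y ∈ U ∧ y ∈ l}.ncard : ZMod p) := fun U l => by
    rw [Set.ncard_eq_toFinset_card']
    simp only [incidenceVector, Set.indicator_apply, Pi.one_apply, sum_boole, filter_filter]
    congr 2
    ext y
    simp [and_comm]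
  intro l
  have := (sub_eq_zero.2 ((hS l).trans (hT l).symm))
  rw [← key, ← key, ← sum_sub_distrib] at this
  exact this

variable [Fintype L] [ProjectivePlane P L]

lemma ncard_line (l : L) : {y : P | y ∈ l}.ncard = ProjectivePlane.order P L + 1 := by
  rw [← ProjectivePlane.pointCount_eq P l]
  rfl

lemma ncard_line_inter_eq_one {l m : L} (h : l ≠ m) :
    {y : P | y ∈ {x : P | x ∈ l} ∧ y ∈ m}.ncard = 1 := by
  rw [Set.ncard_eq_one]
  obtain ⟨z, hz, hz'⟩ := HasPoints.existsUnique_point P L l m h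
  refine ⟨z, Set.ext fun y => ⟨fun hy => hz' y hy, ?_⟩⟩
  rintro rfl
  exact hz

lemma cast_ncard_line_inter {p : ℕ} (hord : ProjectivePlane.order P L = p ^ 2) (l m : L) :
    ({y : P | y ∈ {x : P | x ∈ l} ∧ y ∈ m}.ncard : ZMod p) = 1 := by
  by_cases h : l = m
  · subst h
    simp only [Set.mem_ofPred_eq, and_self]
    rw [ncard_line, hord]
    simp
  · rw [ncard_line_inter_eq_one h, Nat.cast_one]

lemma minWeight_le {F : Type*} [CommRing F] [DecidableEq F] {C : Submodule F (P → F)} {c : P → F}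
    (hc : c ∈ C) (h0 : c ≠ 0) : minWeight C ≤ hammingNorm c :=
  Nat.sInf_le ⟨c, hc, h0, rfl⟩

lemma exists_hammingNorm_eq_minWeight {F : Type*} [CommRing F] [DecidableEq F]
    {C : Submodule F (P → F)} {c : P → F} (hc : c ∈ C) (h0 : c ≠ 0) :
    ∃ c ∈ C, c ≠ 0 ∧ hammingNorm c = minWeight C :=
  Nat.sInf_mem (s := {w | ∃ c ∈ C, c ≠ 0 ∧ hammingNorm c = w}) ⟨_, c, hc, h0, rfl⟩

lemma incidenceVector_sub_ne_zero {F : Type*} [CommRing F] [Nontrivial F] {S T : Set P}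
    {x : P} (hS : x ∈ S) (hT : x ∉ T) : incidenceVector F S - incidenceVector F T ≠ 0 := by
  intro h
  have := congrFun h x
  simp [incidenceVector, hS, hT] at this

/-- The difference of two lines is a dual word, because p²+1 is 1 modulo p. Thus `minWeight` is
attained and is not the default infimum of an empty set. -/
lemma exists_mem_dualCode_ne_zero {p : ℕ} [Fact p.Prime]
    (hord : ProjectivePlane.order P L = p ^ 2) :
    ∃ c ∈ dualCode (code P L (ZMod p)), c ≠ 0 := by
  obtain ⟨x, -, -, l, m, -, hxm, -⟩ := @ProjectivePlane.exists_config P L _ _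
  obtain ⟨l', hl'⟩ : ∃ l' : L, x ∈ l' := by
    have := ProjectivePlane.two_lt_lineCount (L := L) x
    have : Nonempty {l : L // x ∈ l} := (Nat.card_pos_iff.1 (by rw [lineCount] at this; omega)).1
    exact ⟨this.some.1, this.some.2⟩
  exact ⟨_, incidenceVector_sub_mem_dualCode (cast_ncard_line_inter hord l')
    (cast_ncard_line_inter hord m), incidenceVector_sub_ne_zero (x := x) hl' hxm⟩

end Existence

/-! ### Baer subplanes and the upper bound. -/

section Baer

variable {Q M P L : Type*} [Fintype P] [Fintype L] [Membership Q M] [Membership P L]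

lemma IncidenceEmbedding.ncard_range_inter (e : IncidenceEmbedding Q M P L) (m : M) :
    {y : P | y ∈ Set.range e.onPoints ∧ y ∈ e.onLines m}.ncard = pointCount Q m := by
  have : {y : P | y ∈ Set.range e.onPoints ∧ y ∈ e.onLines m} = e.onPoints '' {x | x ∈ m} := by
    ext y
    constructor
    · rintro ⟨⟨x, rfl⟩, h⟩
      exact ⟨x, (e.mem_iff x m).1 h, rfl⟩
    · rintro ⟨x, h, rfl⟩
      exact ⟨⟨x, rfl⟩, (e.mem_iff x m).2 h⟩
  rw [this, Set.ncard_image_of_injective _ e.onPoints_injective]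
  rfl

variable [ProjectivePlane Q M] [ProjectivePlane P L]

lemma IncidenceEmbedding.ncard_range_inter_le_one (e : IncidenceEmbedding Q M P L) {l : L}
    (hl : l ∉ Set.range e.onLines) : {y : P | y ∈ Set.range e.onPoints ∧ y ∈ l}.ncard ≤ 1 := by
  rw [Set.ncard_le_one]
  rintro _ ⟨⟨x, rfl⟩, hx⟩ _ ⟨⟨y, rfl⟩, hy⟩
  by_contra hne
  have hxy : x ≠ y := fun h => hne (h ▸ rfl)
  obtain ⟨h1, h2⟩ := HasLines.mkLine_ax (L := M) hxy
  refine hl ⟨HasLines.mkLine hxy, ?_⟩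
  exact (Nondegenerate.eq_or_eq ((e.mem_iff _ _).2 h1) ((e.mem_iff _ _).2 h2) hx hy).resolve_left
    hne

/-- Every line meets a Baer subplane in `1` or `p + 1` points. -/
lemma IncidenceEmbedding.ncard_range_inter_eq (e : IncidenceEmbedding Q M P L) {p : ℕ}
    (hQ : ProjectivePlane.order Q M = p) (hord : ProjectivePlane.order P L = p ^ 2) (l : L)
    (hl : l ∉ Set.range e.onLines) : {y : P | y ∈ Set.range e.onPoints ∧ y ∈ l}.ncard = 1 := by
  classical
  have hfQ : Finite Q := Finite.of_injective _ e.onPoints_injective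
  have hfM : Finite M := Finite.of_injective _ e.onLines_injective
  have := Fintype.ofFinite Q
  have := Fintype.ofFinite M
  set f : L → ℕ := fun l => {y : P | y ∈ Set.range e.onPoints ∧ y ∈ l}.ncard with hf
  set T : Finset L := univ.image e.onLines with hT
  have hTc : #T = p ^ 2 + p + 1 := by
    rw [hT, card_image_of_injective _ e.onLines_injective, card_univ,
      ProjectivePlane.card_lines Q M, hQ]
  have hsumT : ∑ l ∈ T, f l = (p ^ 2 + p + 1) * (p + 1) := by
    rw [← hTc, ← smul_eq_mul, ← sum_const]
    refine sum_congr rfl fun l hl => ?_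
    obtain ⟨m, -, rfl⟩ := mem_image.1 hl
    simp only [hf]
    rw [e.ncard_range_inter, ProjectivePlane.pointCount_eq, hQ]
  have hsum : ∑ l, f l = (p ^ 2 + p + 1) * (p ^ 2 + 1) := by
    have h1 : ∀ l, f l = ∑ y ∈ univ.image e.onPoints, if y ∈ l then 1 else 0 := fun l => by
      simp only [hf]
      rw [← card_filter, Set.ncard_eq_toFinset_card']
      congr 1
      ext y
      simp
    have h2 : ∀ y : P, ∑ l : L, (if y ∈ l then 1 else 0) = p ^ 2 + 1 := fun y => by
      rw [← card_filter, ← hord, ← card_pencil (L := L) y]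
      unfold pencil
      congr
    simp only [h1]
    rw [sum_comm]
    simp only [h2, sum_const]
    rw [card_image_of_injective _ e.onPoints_injective, card_univ,
      ProjectivePlane.card_points Q M, hQ, smul_eq_mul]
  -- Both sides equal p⁴-p. As each term on the left is at most 1, all are 1.
  have hcompl : ∑ l ∈ Tᶜ, f l = ∑ l ∈ Tᶜ, 1 := by
    have h1 := sum_add_sum_compl T f
    have h2 := card_add_card_compl T
    rw [ProjectivePlane.card_lines P L, hord, hTc] at h2
    rw [hsum, hsumT] at h1
    rw [sum_const, smul_eq_mul, mul_one]
    nlinarith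
  have hle : ∀ l ∈ Tᶜ, f l ≤ 1 := fun l hl => e.ncard_range_inter_le_one fun ⟨m, hm⟩ => by
    rw [mem_compl] at hl
    exact hl (mem_image.2 ⟨m, mem_univ _, hm⟩)
  refine (sum_eq_sum_iff_of_le hle).1 hcompl l ?_
  rw [mem_compl]
  intro h
  obtain ⟨m, -, hm⟩ := mem_image.1 h
  exact hl ⟨m, hm⟩

/-- Subtract from the subplane one of its own lines. They share p+1 points, leaving p² points of the
subplane and p²-p of the line. -/
lemma minWeight_le_of_baerSubplane {p : ℕ} [Fact p.Prime]
    (hord : ProjectivePlane.order P L = p ^ 2) {B : Set P} (hB : IsBaerSubplane L B) :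
    minWeight (dualCode (code P L (ZMod p))) ≤ 2 * p ^ 2 - p := by
  classical
  have hp := (Fact.out : p.Prime).two_le
  obtain ⟨n, hn, Q, M, _, _, e, hQ, rfl⟩ := hB
  rw [hord] at hn
  have hnp : n = p := Nat.pow_left_injective two_ne_zero hn
  subst hnp
  have hfQ : Finite Q := Finite.of_injective _ e.onPoints_injective
  have hfM : Finite M := Finite.of_injective _ e.onLines_injective
  have := Fintype.ofFinite Q
  have := Fintype.ofFinite M
  set B := Set.range e.onPoints with hBdef
  have hBline : ∀ m : M, {y : P | y ∈ B ∧ y ∈ e.onLines m}.ncard = n + 1 := fun m => by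
    rw [e.ncard_range_inter, ProjectivePlane.pointCount_eq, hQ]
  have hS : ∀ l : L, ({y : P | y ∈ B ∧ y ∈ l}.ncard : ZMod n) = 1 := fun l => by
    by_cases hl : l ∈ Set.range e.onLines
    · obtain ⟨m, rfl⟩ := hl
      rw [hBline]
      simp
    · rw [e.ncard_range_inter_eq hQ hord l hl, Nat.cast_one]
  obtain ⟨-, -, -, m, -⟩ := @ProjectivePlane.exists_config Q M _ _
  set T : Set P := {y : P | y ∈ e.onLines m} with hT
  have hBT : (B ∩ T).ncard = n + 1 := hBline m
  have hTc : T.ncard = n ^ 2 + 1 := by rw [hT, ncard_line, hord]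
  have hBc : B.ncard = n ^ 2 + n + 1 := by
    rw [hBdef, ← Set.image_univ, Set.ncard_image_of_injective _ e.onPoints_injective,
      Set.ncard_univ, Nat.card_eq_fintype_card, ProjectivePlane.card_points Q M, hQ]
  have h1 := Set.ncard_inter_add_ncard_sdiff_eq_ncard B T
  have h2 := Set.ncard_inter_add_ncard_sdiff_eq_ncard T B
  rw [Set.inter_comm] at h2
  rw [hBT] at h1 h2
  rw [hBc] at h1
  rw [hTc] at h2
  obtain ⟨x, hx⟩ : (B \ T).Nonempty := by
    rw [← Set.ncard_pos]
    nlinarith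
  have hle : minWeight (dualCode (code P L (ZMod n))) ≤
      hammingNorm (incidenceVector (ZMod n) B - incidenceVector (ZMod n) T) :=
    minWeight_le (incidenceVector_sub_mem_dualCode hS
      (cast_ncard_line_inter hord (e.onLines m)))
      (incidenceVector_sub_ne_zero (F := ZMod n) hx.1 hx.2)
  have hsupp : hammingNorm (incidenceVector (ZMod n) B - incidenceVector (ZMod n) T) ≤
      ((B \ T) ∪ (T \ B)).ncard := by
    rw [hammingNorm, Set.ncard_eq_toFinset_card']
    refine card_le_card fun y hy => ?_
    simp only [mem_filter, mem_univ, true_and] at hy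
    simp only [Set.mem_toFinset, Set.mem_union, Set.mem_sdiff]
    by_contra hcon
    apply hy
    by_cases hyB : y ∈ B <;> by_cases hyT : y ∈ T <;> simp_all [incidenceVector]
  have h3 := hle.trans hsupp
  have h4 := Set.ncard_union_le (B \ T) (T \ B)
  omega

end Baer

/-! ### The gap in the weights and the final assembly. -/

section Main

variable {p : ℕ} [Fact p.Prime] {P : Type*} {L : Type*} [Fintype P] [Fintype L]
  [Membership P L] [ProjectivePlane P L]

/-- For weight at most 2p²+2 the witness is κ+κ'; above that the bound is immediate. -/
lemma le_hammingNorm_add (hp2 : p ≠ 2) {c : P → ZMod p} (hc : IsOrthogonalToLines L c)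
    (hord : ProjectivePlane.order P L = p ^ 2) (h0 : c ≠ 0) :
    ∃ k, hammingNorm c + 2 * p = 2 * p ^ 2 + 2 + k := by
  by_cases hN : hammingNorm c ≤ 2 * p ^ 2 + 2
  · obtain ⟨x, hx⟩ := Function.ne_iff.1 h0
    have hx0 : c x ≠ 0 := hx
    have hnorm := hammingNorm_smul_of_ne_zero c (inv_ne_zero hx0)
    obtain ⟨κ, κ', -, -, h, -⟩ := exists_antipodal_bounds (L := L) (c := (c x)⁻¹ • c) hp2
      (hc.smul _) ⟨x, by simp [hx0]⟩ hord (by rw [hnorm]; exact hN)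
    exact ⟨κ + κ', by rw [← hnorm, h]⟩
  · exact ⟨hammingNorm c + 2 * p - (2 * p ^ 2 + 2), by omega⟩

end Main

end PlaneCode

theorem mainTheorem1 {P : Type u} {L : Type v} [Fintype P] [Fintype L] [Membership P L]
    [Configuration.ProjectivePlane P L] (p : ℕ) (hp : p.Prime) (hp7 : 7 ≤ p)
    (hord : Configuration.ProjectivePlane.order P L = p ^ 2)
    (d : ℕ) (hd : d = PlaneCode.minWeight (PlaneCode.dualCode (PlaneCode.code P L (ZMod p)))) :
    (d = 2 * p ^ 2 - 2 * p + 2 ∨ d = 2 * p ^ 2 - 2 * p + 4 ∨ 2 * p ^ 2 - 2 * p + 5 ≤ d) ∧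
    (d = 2 * p ^ 2 - 2 * p + 2 →
      ∀ c ∈ PlaneCode.dualCode (PlaneCode.code P L (ZMod p)), hammingNorm c = d →
        ∃ (a : ZMod p) (S₁ S₂ : Set P), a ≠ 0 ∧ Disjoint S₁ S₂ ∧
          PlaneCode.IsEmbeddedProjectivePlane L S₁ (p - 1) ∧
          PlaneCode.IsEmbeddedProjectivePlane L S₂ (p - 1) ∧
          c = a • (PlaneCode.incidenceVector (ZMod p) S₁ -
            PlaneCode.incidenceVector (ZMod p) S₂)) ∧
    (d = 2 * p ^ 2 - 2 * p + 4 →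
      ∀ c ∈ PlaneCode.dualCode (PlaneCode.code P L (ZMod p)), hammingNorm c = d →
        ∃ (a : ZMod p) (S₁ S₂ : Set P), a ≠ 0 ∧ Disjoint S₁ S₂ ∧
          PlaneCode.IsEmbeddedAntipodalPlane L S₁ (p - 1) ∧
          PlaneCode.IsEmbeddedAntipodalPlane L S₂ (p - 1) ∧
          c = a • (PlaneCode.incidenceVector (ZMod p) S₁ -
            PlaneCode.incidenceVector (ZMod p) S₂)) ∧
    ((∃ B : Set P, PlaneCode.IsBaerSubplane L B) → d ≤ 2 * p ^ 2 - p) := by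
  have : Fact p.Prime := ⟨hp⟩
  have hp2 : p ≠ 2 := by omega
  have hpp : 2 * p ≤ 2 * p ^ 2 := by nlinarith
  have hshape := fun c (hc : c ∈ PlaneCode.dualCode (PlaneCode.code P L (ZMod p))) k
    (hN : hammingNorm c + 2 * p = 2 * p ^ 2 + 2 + k) (hk : k ≤ 2) =>
    PlaneCode.exists_eq_smul_sub hp7 ((PlaneCode.mem_dualCode_code_iff c).1 hc) hord hN hk
  refine ⟨?_, ?_, ?_, ?_⟩
  · obtain ⟨c, hc, hc0⟩ := PlaneCode.exists_mem_dualCode_ne_zero (p := p) hord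
    obtain ⟨c, hc, hc0, hcd⟩ := PlaneCode.exists_hammingNorm_eq_minWeight hc hc0
    rw [← hd] at hcd
    obtain ⟨k, hk⟩ := PlaneCode.le_hammingNorm_add hp2 ((PlaneCode.mem_dualCode_code_iff c).1 hc)
      hord hc0
    by_cases hk2 : k ≤ 2
    · have := (hshape c hc k hk hk2).1
      omega
    · omega
  · intro hd' c hc hcd
    obtain ⟨-, a, S₁, S₂, ha, hdisj, h, -, heq⟩ := hshape c hc 0 (by omega) (by omega)
    exact ⟨a, S₁, S₂, ha, hdisj, (h rfl).1, (h rfl).2, heq⟩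
  · intro hd' c hc hcd
    obtain ⟨-, a, S₁, S₂, ha, hdisj, -, h, heq⟩ := hshape c hc 2 (by omega) (by omega)
    exact ⟨a, S₁, S₂, ha, hdisj, (h rfl).1, (h rfl).2, heq⟩
  · rintro ⟨B, hB⟩
    rw [hd]
    exact PlaneCode.minWeight_le_of_baerSubplane hord hB
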